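/- **Theorem 1.2.** Let $d,m\ge 1$ and let $T_1,\dots,T_m$ be invertible real $d\times d$ matrices with $\|T_i\|<1/2$ for $1\le i\le m$, where $\|\cdot\|$ is the operator norm for the Euclidean norm on $\mathbb R^d$. Let $\Sigma=\{1,\dots,m\}^{\mathbb N}$ with the product topology, and let $\mu$ be a Borel probability measure on $\Sigma$. *Notation.* For $\mathbf a=(a_1,\dots,a_m)\in(\mathbb R^{d})^m=\mathbb R^{md}$ put $f_i^{\mathbf a}(v)=T_iv+a_i$, let $\pi^{\mathbf a}(x)=\lim_{n\to\infty}f^{\mathbf a}_{x_1}\circ\cdots\circ f^{\mathbf a}_{x_n}(0)$ for $x=(x_i)_{i\ge1}\in\Sigma$, and let $\pi^{\mathbf a}_*\mu$ be the push-forward of $\mu$ by $\pi^{\mathbf a}$. A Borel probability measure $\eta$ on $\mathbb R^d$ is *exact dimensional* if there is a constant $C$ with $\lim_{r\to0^+}\frac{\log\eta(B(x,r))}{\log r}=C$ for $\eta$-a.e. $x$, where $B(x,r)$ is the closed ball. Let $\alpha_1(T)\ge\dots\ge\alpha_d(T)$ be the singular values of a $d\times d$ matrix $T$. For $T$ invertible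 put $$\phi^s(T)=\begin{cases}\alpha_1(T)\cdots\alpha_k(T)\,\alpha_{k+1}(T)^{s-k}, & 0\le s<d,\ k=\lfloor s\rfloor,\\ |\det T|^{s/d}, & d\le s<\infty,\end{cases}\qquad \phi^\infty(T)=0 .$$ For $x\in\Sigma$ write $T_{x|n}=T_{x_1}\cdots T_{x_n}$ (with $T_{x|0}$ the identity matrix) and $[x|n]=\{y\in\Sigma: y_i=x_i \text{ for } 1\le i\le n\}$. For $n\ge1$ let $S_n(\mu,x)$ be the unique $t\in[0,\infty]$ with $\phi^t(T_{x|n})=\mu([x|n])$. For $x,y\in\Sigma$ and $r>0$ let $$Z_{x\wedge y}(r)=\prod_{k=1}^d\frac{\min\{r,\alpha_k(T_{x|j})\}}{\alpha_k(T_{x|j})}$$ if $x\ne y$, where $j\ge 0$ is the length of the longest common initial segment of $x$ and $y$, and let $Z_{x\wedge y}(r)=1$ if $x=y$. Put $G_\mu(x,r)=\int Z_{x\wedge y}(r)\,d\mu(y)$. *Claim.* The measure $\pi^{\mathbf a}_*\mu$ is exact dimensional for Lebesgue-a.e. $\mathbf a\in\mathbb R^{md}$ if and only if one of the following two conditions holds: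 1. $\liminf_{n\to\infty}S_n(\mu,x)\ge d$ for $\mu$-a.e. $x\in\Sigma$; 2. there is $s\in[0,d)$ such that, for $\mu$-a.e. $x\in\Sigma$, $\liminf_{n\to\infty}S_n(\mu,x)=s$ and $\limsup_{r\to0^+}\frac{\log G_\mu(x,r)}{\log r}=s$. -/

import Mathlib

open MeasureTheory Filter Topology
open scoped ENNReal

namespace SelfAffine

noncomputable section

/-- The Euclidean space `ℝ^d`. -/
abbrev E (d : ℕ) : Type := EuclideanSpace ℝ (Fin d)

/-- The one-sided symbolic space over `m` letters, with the product topology and its Borel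
`σ`-algebra. Letters and positions are numbered from `0`. -/
abbrev Shift (m : ℕ) : Type := ℕ → Fin m

/-- The cylinder `[x|n]` of all sequences that agree with `x` in the first `n` letters. -/
def cyl {m : ℕ} (x : Shift m) (n : ℕ) : Set (Shift m) :=
  PiNat.cylinder (E := fun _ => Fin m) x n

/-- The operator norm of a square matrix for the Euclidean norm of `ℝ^d`. -/
def opNorm {d : ℕ} (M : Matrix (Fin d) (Fin d) ℝ) : ℝ :=
  ‖Matrix.toEuclideanCLM (n := Fin d) (𝕜 := ℝ) M‖

/-- The singular values `α_0 ≥ α_1 ≥ ... ≥ α_(d-1)` of a `d × d` matrix (numbered from `0`). -/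
def sv {d : ℕ} (M : Matrix (Fin d) (Fin d) ℝ) (k : ℕ) : ℝ :=
  (Matrix.toEuclideanLin M).singularValues k

/-- The singular value function `φ^s(M)`, for real `s ≥ 0`. -/
def svFun {d : ℕ} (s : ℝ) (M : Matrix (Fin d) (Fin d) ℝ) : ℝ :=
  if s < d then (∏ i ∈ Finset.range ⌊s⌋₊, sv M i) * sv M ⌊s⌋₊ ^ (s - ⌊s⌋₊)
  else |M.det| ^ (s / d)

/-- The singular value function with exponent in `[0, ∞]`, where `φ^∞(M) = 0`. -/
def svFunExt {d : ℕ} (s : ℝ≥0∞) (M : Matrix (Fin d) (Fin d) ℝ) : ℝ :=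
  if s = ⊤ then 0 else svFun s.toReal M

section IFS

variable {d m : ℕ}

/-- The matrix `T_{x|n}`, the product of `T (x 0)`, ..., `T (x (n - 1))` in this order; it is the
identity for `n = 0`. -/
def wordMat (T : Fin m → Matrix (Fin d) (Fin d) ℝ) (x : Shift m) : ℕ → Matrix (Fin d) (Fin d) ℝ
  | 0 => 1
  | n + 1 => wordMat T x n * T (x n)

/-- The affine map `f_i(v) = T_i v + a_i`. -/
def affMap (T : Fin m → Matrix (Fin d) (Fin d) ℝ) (a : Fin m → E d) (i : Fin m) (v : E d) : E d :=
  Matrix.toEuclideanLin (T i) v + a i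

/-- The composition `f_{x 0} ∘ ... ∘ f_{x (n - 1)}`. -/
def wordMap (T : Fin m → Matrix (Fin d) (Fin d) ℝ) (a : Fin m → E d) (x : Shift m) :
    ℕ → E d → E d
  | 0 => id
  | n + 1 => wordMap T a x n ∘ affMap T a (x n)

/-- The coding map `π^a(x) = lim_n f_{x 0} ∘ ... ∘ f_{x (n - 1)} (0)`. The limit exists for all `x`
when the matrices are contracting. -/
def coding (T : Fin m → Matrix (Fin d) (Fin d) ℝ) (a : Fin m → E d) (x : Shift m) : E d :=
  limUnder atTop fun n : ℕ => wordMap T a x n 0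

/-- `S_n(μ, x)`, the number `t ∈ [0, ∞]` with `φ^t(T_{x|n}) = μ([x|n])`. For `n ≥ 1` and
contracting invertible matrices there is exactly one such `t`, so that the infimum is over
a singleton. -/
def S (T : Fin m → Matrix (Fin d) (Fin d) ℝ) (μ : Measure (Shift m)) (n : ℕ) (x : Shift m) :
    ℝ≥0∞ :=
  sInf {t : ℝ≥0∞ | svFunExt t (wordMat T x n) = μ.real (cyl x n)}

open scoped Classical in
/-- `Z_{x∧y}(r)`. For `x ≠ y`, `PiNat.firstDiff x y` is the length of the common initial
segment `x ∧ y`, so that `wordMat T x (PiNat.firstDiff x y)` is `T_{x∧y}`. -/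
def Z (T : Fin m → Matrix (Fin d) (Fin d) ℝ) (x y : Shift m) (r : ℝ) : ℝ :=
  if x = y then 1
  else ∏ k ∈ Finset.range d,
    min r (sv (wordMat T x (PiNat.firstDiff (E := fun _ => Fin m) x y)) k) /
      sv (wordMat T x (PiNat.firstDiff (E := fun _ => Fin m) x y)) k

/-- `G_μ(x, r) = ∫ Z_{x∧y}(r) dμ(y)`. -/
def G (T : Fin m → Matrix (Fin d) (Fin d) ℝ) (μ : Measure (Shift m)) (x : Shift m) (r : ℝ) : ℝ :=
  ∫ y, Z T x y r ∂μ

/-- `D(μ, x) = limsup_{r → 0} log G_μ(x, r) / log r`. -/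
def D (T : Fin m → Matrix (Fin d) (Fin d) ℝ) (μ : Measure (Shift m)) (x : Shift m) : EReal :=
  limsup (fun r : ℝ => ((Real.log (G T μ x r) / Real.log r : ℝ) : EReal)) (𝓝[>] 0)

end IFS

/-- The quotient `log η(B(x, r)) / log r` with the closed ball `B(x, r)`, where `log 0 = -∞`. -/
def logRatio {d : ℕ} (η : Measure (E d)) (x : E d) (r : ℝ) : EReal :=
  ENNReal.log (η (Metric.closedBall x r)) / ((Real.log r : ℝ) : EReal)

/-- The lower local dimension of `η` at `x`. -/
def lowerLocDim {d : ℕ} (η : Measure (E d)) (x : E d) : EReal :=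
  liminf (logRatio η x) (𝓝[>] 0)

/-- The upper local dimension of `η` at `x`. -/
def upperLocDim {d : ℕ} (η : Measure (E d)) (x : E d) : EReal :=
  limsup (logRatio η x) (𝓝[>] 0)

/-- `η` is exact dimensional: for some constant `C` the local dimension exists and equals `C` at
`η`-almost every point. -/
def ExactDimensional {d : ℕ} (η : Measure (E d)) : Prop :=
  ∃ C : ℝ, ∀ᵐ x ∂η, lowerLocDim η x = (C : EReal) ∧ upperLocDim η x = (C : EReal)

end

end SelfAffine

/-
Because the matrices have norm less than `1/2`, for `x ≠ y` the map `a ↦ π^a(x) - π^a(y)` is linear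
and, up to the factor `T_{x∧y}`, onto with a uniform lower bound. Hence the integral over bounded
`a` of the `μ`-measure of the `y` with `|π^a(x) - π^a(y)| ≤ r` is at most a constant times
`G_μ(x, r)`, and by Borel-Cantelli along `r = 2^{-n}`, for almost every `a`,
`(π^a_* μ)(B(π^a(x), r)) ≤ r^{-ε} G_μ(x, r)` for `μ`-almost every `x` and all small `r`. Conversely,
for every `a`, the image of the cylinder `[x|j]` is covered by about `1 / Z(r)` cells of diameter
`r`, where `Z(r)` is the product defined by the singular values of `T_{x|j}`. The points of `[x|j]`
lying in cells of small measure are therefore rare, which gives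
`G_μ(x, r) ≤ r^{-ε} (π^a_* μ)(B(π^a(x), r))`. So for almost every `a` the lower and upper local
dimensions of `π^a_* μ` at `π^a(x)` are the lower and upper limits of `log G_μ(x, r) / log r`. The
upper limit is `D(μ, x)`. The lower limit is `min(d, liminf S_n(μ, x))`, because `φ^t(T) Z(r) ≤ r^t`
for all `r`, with equality for `r = α_{⌊t⌋}(T)`.
-/

namespace SelfAffine

noncomputable section

section SingularValues

variable {𝕜 V W X : Type*} [RCLike 𝕜]
  [NormedAddCommGroup V] [InnerProductSpace 𝕜 V] [FiniteDimensional 𝕜 V]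
  [NormedAddCommGroup W] [InnerProductSpace 𝕜 W] [FiniteDimensional 𝕜 W]
  [NormedAddCommGroup X] [InnerProductSpace 𝕜 X] [FiniteDimensional 𝕜 X]

/-- The right singular vectors of `A`, ordered by decreasing singular value: an orthonormal basis
of eigenvectors of `A* A`. -/
def rightSingularBasis (A : V →ₗ[𝕜] W) {n : ℕ} (hn : Module.finrank 𝕜 V = n) :
    OrthonormalBasis (Fin n) 𝕜 V :=
  A.isSymmetric_adjoint_comp_self.eigenvectorBasis hn

lemma sq_norm_apply_eq_sum (A : V →ₗ[𝕜] W) {n : ℕ} (hn : Module.finrank 𝕜 V = n) (v : V) :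
    ‖A v‖ ^ 2 = ∑ k : Fin n,
      (A.singularValues k * ‖(rightSingularBasis A hn).repr v k‖) ^ 2 := by
  have h : ((‖A v‖ ^ 2 : ℝ) : 𝕜) = inner 𝕜 v ((LinearMap.adjoint A ∘ₗ A) v) := by
    rw [LinearMap.comp_apply, LinearMap.adjoint_inner_right, inner_self_eq_norm_sq_to_K]
    push_cast
    rfl
  rw [← RCLike.ofReal_inj (K := 𝕜), h, ← (rightSingularBasis A hn).repr.inner_map_map,
    PiLp.inner_apply, RCLike.ofReal_sum]
  refine Finset.sum_congr rfl fun k _ => ?_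
  rw [rightSingularBasis, LinearMap.IsSymmetric.eigenvectorBasis_apply_self_apply,
    ← A.sq_singularValues_fin hn k, RCLike.inner_apply, mul_pow, mul_assoc, RCLike.mul_conj]
  push_cast
  rfl

lemma singularValues_mul_norm_repr_le (A : V →ₗ[𝕜] W) {n : ℕ} (hn : Module.finrank 𝕜 V = n)
    (v : V) (k : Fin n) :
    A.singularValues k * ‖(rightSingularBasis A hn).repr v k‖ ≤ ‖A v‖ := by
  refine le_of_sq_le_sq ?_ (norm_nonneg _)
  rw [sq_norm_apply_eq_sum A hn v]
  exact Finset.single_le_sum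
    (f := fun k : Fin n => (A.singularValues k * ‖(rightSingularBasis A hn).repr v k‖) ^ 2)
    (fun _ _ => sq_nonneg _) (Finset.mem_univ k)

lemma norm_apply_le_sum (A : V →ₗ[𝕜] W) {n : ℕ} (hn : Module.finrank 𝕜 V = n) (v : V) :
    ‖A v‖ ≤ ∑ k : Fin n, A.singularValues k * ‖(rightSingularBasis A hn).repr v k‖ := by
  have hterm : ∀ k ∈ (Finset.univ : Finset (Fin n)),
      0 ≤ A.singularValues k * ‖(rightSingularBasis A hn).repr v k‖ :=
    fun k _ => mul_nonneg (A.singularValues_nonneg k) (norm_nonneg _)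
  refine le_of_sq_le_sq ?_ (Finset.sum_nonneg hterm)
  rw [sq_norm_apply_eq_sum A hn v]
  exact Finset.sum_sq_le_sq_sum_of_nonneg hterm

lemma exists_submodule_forall_repr_eq_zero {ι : Type*} [Fintype ι] (b : OrthonormalBasis ι 𝕜 V)
    (s : Finset ι) : ∃ U : Submodule 𝕜 V, Module.finrank 𝕜 V ≤ Module.finrank 𝕜 U + s.card ∧
      ∀ u ∈ U, ∀ i ∈ s, b.repr u i = 0 := by
  let P : V →ₗ[𝕜] (s → 𝕜) := LinearMap.pi fun i => innerₛₗ 𝕜 (b i)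
  refine ⟨LinearMap.ker P, ?_, fun u hu i hi => ?_⟩
  · have h := LinearMap.finrank_range_add_finrank_ker P
    have h' : Module.finrank 𝕜 (LinearMap.range P) ≤ s.card :=
      (LinearMap.range P).finrank_le.trans_eq (by simp)
    omega
  · rw [b.repr_apply_apply]
    exact congrFun hu ⟨i, hi⟩

lemma exists_submodule_singularValues_mul_norm_le (A : V →ₗ[𝕜] W) {k : ℕ}
    (hk : k < Module.finrank 𝕜 V) :
    ∃ U : Submodule 𝕜 V, k < Module.finrank 𝕜 U ∧
      ∀ u ∈ U, A.singularValues k * ‖u‖ ≤ ‖A u‖ := by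
  obtain ⟨U, hU, hrepr⟩ := exists_submodule_forall_repr_eq_zero (rightSingularBasis A rfl)
    (Finset.Ioi ⟨k, hk⟩)
  refine ⟨U, by grind [Fin.card_Ioi], fun u hu => le_of_sq_le_sq ?_ (norm_nonneg _)⟩
  rw [sq_norm_apply_eq_sum A rfl, mul_pow, ← (rightSingularBasis A rfl).repr.norm_map u,
    EuclideanSpace.norm_sq_eq, Finset.mul_sum]
  refine Finset.sum_le_sum fun i _ => ?_
  rw [← mul_pow]
  rcases lt_or_ge k i with hi | hi
  · simp [hrepr u hu i (Finset.mem_Ioi.2 hi)]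
  · gcongr
    · exact mul_nonneg (A.singularValues_nonneg k) (norm_nonneg _)
    · exact A.singularValues_antitone hi

lemma exists_submodule_norm_apply_le (A : V →ₗ[𝕜] W) (k : ℕ) :
    ∃ U : Submodule 𝕜 V, Module.finrank 𝕜 V ≤ Module.finrank 𝕜 U + k ∧
      ∀ u ∈ U, ‖A u‖ ≤ A.singularValues k * ‖u‖ := by
  obtain ⟨U, hU, hrepr⟩ := exists_submodule_forall_repr_eq_zero (rightSingularBasis A rfl)
    {i | (i : ℕ) < k}
  have hcard : (Finset.univ.filter fun i : Fin (Module.finrank 𝕜 V) => (i : ℕ) < k).card ≤ k := by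
    rw [Fin.card_filter_val_lt]
    exact min_le_right _ _
  refine ⟨U, by omega, fun u hu => le_of_sq_le_sq ?_
    (mul_nonneg (A.singularValues_nonneg k) (norm_nonneg _))⟩
  rw [sq_norm_apply_eq_sum A rfl, mul_pow, ← (rightSingularBasis A rfl).repr.norm_map u,
    EuclideanSpace.norm_sq_eq, Finset.mul_sum]
  refine Finset.sum_le_sum fun i _ => ?_
  rw [← mul_pow]
  rcases lt_or_ge (i : ℕ) k with hi | hi
  · simp [hrepr u hu i (by simpa using hi)]
  · gcongr
    · exact mul_nonneg (A.singularValues_nonneg i) (norm_nonneg _)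
    · exact A.singularValues_antitone hi

lemma singularValues_le_norm (A : V →L[𝕜] W) (k : ℕ) :
    (A : V →ₗ[𝕜] W).singularValues k ≤ ‖A‖ := by
  rcases le_or_gt (Module.finrank 𝕜 V) k with hk | hk
  · rw [LinearMap.singularValues_of_finrank_le _ hk]
    exact norm_nonneg A
  obtain ⟨U, hU, hA⟩ := exists_submodule_singularValues_mul_norm_le (A : V →ₗ[𝕜] W) hk
  have : Nontrivial U := Module.nontrivial_of_finrank_pos (k.zero_le.trans_lt hU)
  obtain ⟨u, hu⟩ := exists_ne (0 : U)
  exact le_of_mul_le_mul_right ((hA u u.2).trans (A.le_opNorm u)) (norm_pos_iff.2 (by simpa))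

lemma singularValues_comp_le (A : V →ₗ[𝕜] W) (B : X →L[𝕜] V) (k : ℕ) :
    (A ∘ₗ (B : X →ₗ[𝕜] V)).singularValues k ≤ A.singularValues k * ‖B‖ := by
  rcases le_or_gt (Module.finrank 𝕜 X) k with hk | hk
  · rw [LinearMap.singularValues_of_finrank_le _ hk]
    exact mul_nonneg (A.singularValues_nonneg k) (norm_nonneg B)
  obtain ⟨U, hU, hAB⟩ := exists_submodule_singularValues_mul_norm_le (A ∘ₗ (B : X →ₗ[𝕜] V)) hk
  obtain ⟨U', hU', hA⟩ := exists_submodule_norm_apply_le A k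
  have hlt : Module.finrank 𝕜 (V ⧸ U') < Module.finrank 𝕜 U := by
    have := U'.finrank_quotient_add_finrank
    omega
  obtain ⟨u, hBu, hu⟩ := (Submodule.ne_bot_iff _).1 (LinearMap.ker_ne_bot_of_finrank_lt
    (f := U'.mkQ ∘ₗ (B : X →ₗ[𝕜] V) ∘ₗ U.subtype) hlt)
  have hBu : B u ∈ U' := (Submodule.Quotient.mk_eq_zero U').1 hBu
  refine le_of_mul_le_mul_right ?_ (norm_pos_iff.2 (by simpa using hu) : 0 < ‖(u : X)‖)
  calc (A ∘ₗ (B : X →ₗ[𝕜] V)).singularValues k * ‖(u : X)‖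
      ≤ ‖A (B u)‖ := hAB u u.2
    _ ≤ A.singularValues k * ‖B u‖ := hA _ hBu
    _ ≤ A.singularValues k * (‖B‖ * ‖(u : X)‖) := by
        gcongr
        · exact A.singularValues_nonneg k
        · exact B.le_opNorm u
    _ = _ := (mul_assoc _ _ _).symm

end SingularValues

section MatrixSingularValues

variable {d : ℕ}

lemma norm_toEuclideanLin_le (M : Matrix (Fin d) (Fin d) ℝ) (v : E d) :
    ‖M.toEuclideanLin v‖ ≤ opNorm M * ‖v‖ :=
  (Matrix.toEuclideanCLM (n := Fin d) (𝕜 := ℝ) M).le_opNorm v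

lemma opNorm_nonneg (M : Matrix (Fin d) (Fin d) ℝ) : 0 ≤ opNorm M := norm_nonneg _

lemma opNorm_mul_le (A B : Matrix (Fin d) (Fin d) ℝ) : opNorm (A * B) ≤ opNorm A * opNorm B := by
  unfold opNorm
  rw [map_mul]
  exact norm_mul_le _ _

lemma opNorm_one_le : opNorm (1 : Matrix (Fin d) (Fin d) ℝ) ≤ 1 := by
  unfold opNorm
  rw [map_one]
  exact ContinuousLinearMap.norm_id_le

lemma toEuclideanLin_mul_apply (A B : Matrix (Fin d) (Fin d) ℝ) (v : E d) :
    (A * B).toEuclideanLin v = A.toEuclideanLin (B.toEuclideanLin v) :=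
  congrArg (fun f : E d →L[ℝ] E d => f v)
    (map_mul (Matrix.toEuclideanCLM (n := Fin d) (𝕜 := ℝ)) A B)

lemma toEuclideanLin_one_apply (v : E d) :
    (1 : Matrix (Fin d) (Fin d) ℝ).toEuclideanLin v = v :=
  congrArg (fun f : E d →L[ℝ] E d => f v)
    (map_one (Matrix.toEuclideanCLM (n := Fin d) (𝕜 := ℝ)))

lemma toEuclideanLin_injective {M : Matrix (Fin d) (Fin d) ℝ} (hM : IsUnit M) :
    Function.Injective M.toEuclideanLin := by
  obtain ⟨N, hN⟩ := hM.exists_left_inv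
  refine Function.LeftInverse.injective (g := N.toEuclideanLin) fun v => ?_
  rw [← toEuclideanLin_mul_apply, hN, toEuclideanLin_one_apply]

lemma sv_nonneg (M : Matrix (Fin d) (Fin d) ℝ) (k : ℕ) : 0 ≤ sv M k :=
  LinearMap.singularValues_nonneg _ k

lemma sv_antitone (M : Matrix (Fin d) (Fin d) ℝ) : Antitone (sv M) :=
  LinearMap.singularValues_antitone _

lemma sv_pos {M : Matrix (Fin d) (Fin d) ℝ} (hM : IsUnit M) {k : ℕ} (hk : k < d) :
    0 < sv M k :=
  (LinearMap.injective_iff_forall_lt_finrank_singularValues_pos _).1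
    (toEuclideanLin_injective hM) k (by simpa using hk)

lemma sv_le_opNorm (M : Matrix (Fin d) (Fin d) ℝ) (k : ℕ) : sv M k ≤ opNorm M :=
  singularValues_le_norm (Matrix.toEuclideanCLM (n := Fin d) (𝕜 := ℝ) M) k

lemma sv_mul_le (A B : Matrix (Fin d) (Fin d) ℝ) (k : ℕ) :
    sv (A * B) k ≤ sv A k * opNorm B := by
  have h : (A * B).toEuclideanLin = A.toEuclideanLin ∘ₗ B.toEuclideanLin :=
    LinearMap.ext (toEuclideanLin_mul_apply A B)
  unfold sv
  rw [h]
  exact singularValues_comp_le A.toEuclideanLin (Matrix.toEuclideanCLM (n := Fin d) (𝕜 := ℝ) B) k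

end MatrixSingularValues

section SingularValueFunction

variable {d : ℕ}

/-- The product in the definition of `Z`, so that `Z_{x∧y}(r) = zFun T_{x∧y} r`. Up to a constant it
is the reciprocal of the number of balls of radius `r` needed to cover the image of the unit ball
under `M`. -/
def zFun (M : Matrix (Fin d) (Fin d) ℝ) (r : ℝ) : ℝ :=
  ∏ k ∈ Finset.range d, min r (sv M k) / sv M k

lemma zFun_eq_prod {M : Matrix (Fin d) (Fin d) ℝ} (hM : IsUnit M) (r : ℝ) :
    zFun M r = ∏ k ∈ Finset.range d, min (r / sv M k) 1 := by
  refine Finset.prod_congr rfl fun k hk => ?_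
  have := sv_pos hM (Finset.mem_range.1 hk)
  rw [← min_div_div_right this.le, div_self this.ne']

lemma zFun_nonneg (M : Matrix (Fin d) (Fin d) ℝ) {r : ℝ} (hr : 0 ≤ r) : 0 ≤ zFun M r :=
  Finset.prod_nonneg fun k _ => div_nonneg (le_min hr (sv_nonneg M k)) (sv_nonneg M k)

lemma zFun_pos {M : Matrix (Fin d) (Fin d) ℝ} (hM : IsUnit M) {r : ℝ} (hr : 0 < r) :
    0 < zFun M r := by
  rw [zFun_eq_prod hM]
  exact Finset.prod_pos fun k hk =>
    lt_min (div_pos hr (sv_pos hM (Finset.mem_range.1 hk))) one_pos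

lemma zFun_le_one (M : Matrix (Fin d) (Fin d) ℝ) {r : ℝ} (hr : 0 ≤ r) : zFun M r ≤ 1 :=
  Finset.prod_le_one (fun k _ => div_nonneg (le_min hr (sv_nonneg M k)) (sv_nonneg M k))
    fun k _ => div_le_one_of_le₀ (min_le_right _ _) (sv_nonneg M k)

lemma zFun_eq_one {M : Matrix (Fin d) (Fin d) ℝ} (hM : IsUnit M) {r : ℝ} (h : opNorm M ≤ r) :
    zFun M r = 1 := by
  rw [zFun_eq_prod hM]
  refine Finset.prod_eq_one fun k hk => min_eq_right ?_
  rw [one_le_div (sv_pos hM (Finset.mem_range.1 hk))]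
  exact (sv_le_opNorm M k).trans h

lemma zFun_mono (M : Matrix (Fin d) (Fin d) ℝ) {r r' : ℝ} (hr : 0 ≤ r) (h : r ≤ r') :
    zFun M r ≤ zFun M r' :=
  Finset.prod_le_prod (fun k _ => div_nonneg (le_min hr (sv_nonneg M k)) (sv_nonneg M k))
    fun k _ => div_le_div_of_nonneg_right (min_le_min_right _ h) (sv_nonneg M k)

lemma zFun_mul_le (M : Matrix (Fin d) (Fin d) ℝ) {c r : ℝ} (hc : 1 ≤ c) (hr : 0 ≤ r) :
    zFun M (c * r) ≤ c ^ d * zFun M r := by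
  have hcr : 0 ≤ c * r := mul_nonneg (zero_le_one.trans hc) hr
  have hprod : c ^ d = ∏ _k ∈ Finset.range d, c := by simp
  rw [hprod, zFun, zFun, ← Finset.prod_mul_distrib]
  refine Finset.prod_le_prod
    (fun k _ => div_nonneg (le_min hcr (sv_nonneg M k)) (sv_nonneg M k)) fun k _ => ?_
  rw [← mul_div_assoc, mul_min_of_nonneg _ _ (zero_le_one.trans hc)]
  exact div_le_div_of_nonneg_right
    (min_le_min_left _ (le_mul_of_one_le_left (sv_nonneg M k) hc)) (sv_nonneg M k)

lemma pow_le_zFun {M : Matrix (Fin d) (Fin d) ℝ} (hM : IsUnit M) (h : opNorm M ≤ 1) {r : ℝ}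
    (hr : 0 ≤ r) (hr1 : r ≤ 1) : r ^ d ≤ zFun M r := by
  have hprod : r ^ d = ∏ _k ∈ Finset.range d, r := by simp
  rw [zFun_eq_prod hM, hprod]
  refine Finset.prod_le_prod (fun _ _ => hr) fun k hk => le_min ?_ hr1
  rw [le_div_iff₀ (sv_pos hM (Finset.mem_range.1 hk))]
  exact mul_le_of_le_one_right hr ((sv_le_opNorm M k).trans h)

lemma zFun_le_zFun_mul {A B : Matrix (Fin d) (Fin d) ℝ} (hA : IsUnit A) (hB : IsUnit B)
    (h : opNorm B ≤ 1) {r : ℝ} (hr : 0 ≤ r) : zFun A r ≤ zFun (A * B) r := by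
  rw [zFun_eq_prod hA, zFun_eq_prod (hA.mul hB)]
  refine Finset.prod_le_prod
    (fun k _ => le_min (div_nonneg hr (sv_nonneg A k)) zero_le_one) fun k hk => ?_
  refine min_le_min_right _ (div_le_div_of_nonneg_left hr
    (sv_pos (hA.mul hB) (Finset.mem_range.1 hk)) ?_)
  exact (sv_mul_le A B k).trans (mul_le_of_le_one_right (sv_nonneg A k) h)

/-- The exponent of the `k`-th singular value in `φ^s`. -/
def svExp (s : ℝ) (k : ℕ) : ℝ := max 0 (min 1 (s - k))

lemma svExp_nonneg (s : ℝ) (k : ℕ) : 0 ≤ svExp s k := le_max_left _ _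

lemma svExp_le_one (s : ℝ) (k : ℕ) : svExp s k ≤ 1 :=
  max_le zero_le_one (min_le_left _ _)

lemma svExp_mono {s t : ℝ} (h : s ≤ t) (k : ℕ) : svExp s k ≤ svExp t k :=
  max_le_max_left _ (min_le_min_left _ (by linarith))

lemma svExp_of_lt_floor {s : ℝ} {k : ℕ} (hk : k < ⌊s⌋₊) : svExp s k = 1 := by
  have hks : ((k + 1 : ℕ) : ℝ) ≤ s := (Nat.le_floor_iff' k.succ_ne_zero).1 hk
  push_cast at hks
  rw [svExp, min_eq_left (by linarith), max_eq_right zero_le_one]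

lemma svExp_floor {s : ℝ} (hs : 0 ≤ s) : svExp s ⌊s⌋₊ = s - ⌊s⌋₊ := by
  rw [svExp, min_eq_right (by linarith [Nat.lt_floor_add_one s]),
    max_eq_right (by linarith [Nat.floor_le hs])]

lemma svExp_of_floor_lt {s : ℝ} {k : ℕ} (hk : ⌊s⌋₊ < k) : svExp s k = 0 := by
  have hsk : s < k := Nat.lt_of_floor_lt hk
  rw [svExp, min_eq_right (by linarith), max_eq_left (by linarith)]

lemma sum_svExp {s : ℝ} (hs : 0 ≤ s) (n : ℕ) :
    ∑ k ∈ Finset.range n, svExp s k = min s n := by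
  induction n with
  | zero => simp [hs]
  | succ n ih =>
    rw [Finset.sum_range_succ, ih, svExp]
    push_cast
    grind

lemma svFun_eq_prod {s : ℝ} (hs : 0 ≤ s) (hsd : s < d) (M : Matrix (Fin d) (Fin d) ℝ) :
    svFun s M = ∏ k ∈ Finset.range d, sv M k ^ svExp s k := by
  have hk : ⌊s⌋₊ < d := (Nat.floor_lt hs).2 hsd
  obtain ⟨l, rfl⟩ : ∃ l, d = ⌊s⌋₊ + (1 + l) := ⟨d - ⌊s⌋₊ - 1, by omega⟩
  rw [svFun, if_pos hsd, Finset.prod_range_add, Finset.prod_range_add]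
  have htail : ∏ x ∈ Finset.range l, sv M (⌊s⌋₊ + (1 + x)) ^ svExp s (⌊s⌋₊ + (1 + x)) = 1 :=
    Finset.prod_eq_one fun x _ => by rw [svExp_of_floor_lt (by omega), Real.rpow_zero]
  rw [htail, mul_one, Finset.prod_range_one, add_zero, svExp_floor hs]
  congr 1
  refine Finset.prod_congr rfl fun k hk => ?_
  rw [svExp_of_lt_floor (Finset.mem_range.1 hk), Real.rpow_one]

lemma prod_rpow_svExp {s : ℝ} (hs : 0 ≤ s) (hsd : s ≤ d) {r : ℝ} (hr : 0 < r) :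
    ∏ k ∈ Finset.range d, r ^ svExp s k = r ^ s := by
  rw [← Real.rpow_sum_of_pos hr, sum_svExp hs, min_eq_left hsd]

lemma min_div_one_mul_rpow_le {a r e : ℝ} (ha : 0 < a) (hr : 0 < r) (he : 0 ≤ e)
    (he' : e ≤ 1) : min (r / a) 1 * a ^ e ≤ r ^ e := by
  have hmin : 0 < min (r / a) 1 := lt_min (div_pos hr ha) one_pos
  calc min (r / a) 1 * a ^ e ≤ min (r / a) 1 ^ e * a ^ e := by
        gcongr
        exact Real.self_le_rpow_of_le_one hmin.le (min_le_right _ _) he'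
    _ ≤ (r / a) ^ e * a ^ e := by
        gcongr
        exact min_le_left _ _
    _ = r ^ e := by rw [← Real.mul_rpow (by positivity) ha.le, div_mul_cancel₀ _ ha.ne']

lemma zFun_mul_svFun_le {M : Matrix (Fin d) (Fin d) ℝ} (hM : IsUnit M) {s : ℝ} (hs : 0 ≤ s)
    (hsd : s < d) {r : ℝ} (hr : 0 < r) : zFun M r * svFun s M ≤ r ^ s := by
  rw [svFun_eq_prod hs hsd, zFun_eq_prod hM, ← prod_rpow_svExp hs hsd.le hr,
    ← Finset.prod_mul_distrib]
  refine Finset.prod_le_prod (fun k hk => ?_) fun k hk => ?_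
  all_goals have hα : 0 < sv M k := sv_pos hM (Finset.mem_range.1 hk)
  · positivity
  · exact min_div_one_mul_rpow_le hα hr (svExp_nonneg s k) (svExp_le_one s k)

lemma zFun_mul_svFun_eq {M : Matrix (Fin d) (Fin d) ℝ} (hM : IsUnit M) {s : ℝ} (hs : 0 ≤ s)
    (hsd : s < d) : zFun M (sv M ⌊s⌋₊) * svFun s M = sv M ⌊s⌋₊ ^ s := by
  have hα : ∀ k ∈ Finset.range d, 0 < sv M k := fun k hk => sv_pos hM (Finset.mem_range.1 hk)
  have hr : 0 < sv M ⌊s⌋₊ := sv_pos hM ((Nat.floor_lt hs).2 hsd)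
  rw [svFun_eq_prod hs hsd, zFun_eq_prod hM, ← prod_rpow_svExp hs hsd.le hr,
    ← Finset.prod_mul_distrib]
  refine Finset.prod_congr rfl fun k hk => ?_
  have hk := hα k hk
  rcases lt_trichotomy k ⌊s⌋₊ with h | h | h
  · rw [svExp_of_lt_floor h, min_eq_left ((div_le_one hk).2 (sv_antitone M h.le)), Real.rpow_one,
      Real.rpow_one, div_mul_cancel₀ _ hk.ne']
  · rw [h] at hk ⊢
    rw [div_self hk.ne', min_self, one_mul]
  · rw [svExp_of_floor_lt h, min_eq_right ((one_le_div hk).2 (sv_antitone M h.le))]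
    simp

lemma svFun_pos {M : Matrix (Fin d) (Fin d) ℝ} (hM : IsUnit M) {s : ℝ} (hs : 0 ≤ s)
    (hsd : s < d) : 0 < svFun s M := by
  rw [svFun_eq_prod hs hsd]
  exact Finset.prod_pos fun k hk => Real.rpow_pos_of_pos (sv_pos hM (Finset.mem_range.1 hk)) _

lemma svFun_anti {M : Matrix (Fin d) (Fin d) ℝ} (hM : IsUnit M) (h1 : opNorm M ≤ 1) {s t : ℝ}
    (hs : 0 ≤ s) (hst : s ≤ t) (htd : t < d) : svFun t M ≤ svFun s M := by
  rw [svFun_eq_prod hs (hst.trans_lt htd), svFun_eq_prod (hs.trans hst) htd]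
  refine Finset.prod_le_prod (fun k _ => Real.rpow_nonneg (sv_nonneg M k) _) fun k hk => ?_
  exact Real.rpow_le_rpow_of_exponent_ge (sv_pos hM (Finset.mem_range.1 hk))
    ((sv_le_opNorm M k).trans h1) (svExp_mono hst k)

lemma svFun_zero (hd : 0 < d) (M : Matrix (Fin d) (Fin d) ℝ) : svFun 0 M = 1 := by
  simp [svFun, hd]

lemma continuousOn_svFun {M : Matrix (Fin d) (Fin d) ℝ} (hM : IsUnit M) :
    ContinuousOn (fun s => svFun s M) (Set.Ico 0 d) := by
  have h : Continuous fun s : ℝ => ∏ k ∈ Finset.range d, sv M k ^ svExp s k := by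
    refine continuous_finsetProd _ fun k hk => Continuous.rpow continuous_const ?_
      fun _ => Or.inl (sv_pos hM (Finset.mem_range.1 hk)).ne'
    unfold svExp
    fun_prop
  exact h.continuousOn.congr fun s hs => svFun_eq_prod hs.1 hs.2 M

lemma exists_svFun_eq {M : Matrix (Fin d) (Fin d) ℝ} (hM : IsUnit M) {t : ℝ} (ht : 0 ≤ t)
    (htd : t < d) {p : ℝ} (hp : svFun t M ≤ p) (hp1 : p ≤ 1) :
    ∃ s ∈ Set.Icc 0 t, svFun s M = p := by
  have hd : 0 < d := by exact_mod_cast ht.trans_lt htd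
  exact intermediate_value_Icc' ht
    ((continuousOn_svFun hM).mono (Set.Icc_subset_Ico_right htd)) ⟨hp, by rwa [svFun_zero hd]⟩

end SingularValueFunction

section Geometry

lemma volume_forall_abs_repr_le {V ι : Type*} [NormedAddCommGroup V] [InnerProductSpace ℝ V]
    [FiniteDimensional ℝ V] [MeasurableSpace V] [BorelSpace V] [Fintype ι]
    (b : OrthonormalBasis ι ℝ V) (c : ι → ℝ) :
    volume {v : V | ∀ i, |b.repr v i| ≤ c i} = ∏ i, ENNReal.ofReal (2 * c i) := by
  have hpres : MeasurePreserving (fun v : V => WithLp.ofLp (b.repr v)) volume volume :=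
    (EuclideanSpace.volume_preserving_symm_measurableEquiv_toLp ι).comp b.measurePreserving_repr
  have hbox : {v : V | ∀ i, |b.repr v i| ≤ c i} = (fun v : V => WithLp.ofLp (b.repr v)) ⁻¹'
      (Set.univ.pi fun i => Set.Icc (-c i) (c i)) := by
    ext v
    simp only [abs_le, Set.mem_ofPred_eq, Set.mem_preimage, Set.mem_univ_pi, Set.mem_Icc]
  rw [hbox, hpres.measure_preimage
    (MeasurableSet.univ_pi fun _ => measurableSet_Icc).nullMeasurableSet, volume_pi_pi]
  simp_rw [Real.volume_Icc, sub_neg_eq_add, ← two_mul]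

lemma volume_preimage_le_of_antilipschitzWith {V V' : Type*}
    [NormedAddCommGroup V] [InnerProductSpace ℝ V] [FiniteDimensional ℝ V]
    [MeasurableSpace V] [BorelSpace V]
    [NormedAddCommGroup V'] [InnerProductSpace ℝ V'] [FiniteDimensional ℝ V']
    [MeasurableSpace V'] [BorelSpace V']
    (hVV' : Module.finrank ℝ V = Module.finrank ℝ V')
    {K : NNReal} {g : V → V'} (hg : AntilipschitzWith K g) (s : Set V') :
    volume (g ⁻¹' s) ≤ K ^ Module.finrank ℝ V * volume s := by
  rw [← InnerProductSpace.euclideanHausdorffMeasure_eq_volume (V := V),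
    ← InnerProductSpace.euclideanHausdorffMeasure_eq_volume (V := V'), ← hVV',
    Measure.euclideanHausdorffMeasure_def, Measure.euclideanHausdorffMeasure_def,
    Measure.smul_apply, Measure.smul_apply, ENNReal.smul_def, ENNReal.smul_def, smul_eq_mul,
    smul_eq_mul, mul_left_comm]
  gcongr
  simpa only [ENNReal.rpow_natCast] using
    hg.hausdorffMeasure_preimage_le (Nat.cast_nonneg (Module.finrank ℝ V)) s

variable {d : ℕ}

/-- The orthonormal basis of `ℝ^d` formed by the right singular vectors of `M`. -/
def svBasis (M : Matrix (Fin d) (Fin d) ℝ) : OrthonormalBasis (Fin d) ℝ (E d) :=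
  rightSingularBasis M.toEuclideanLin finrank_euclideanSpace_fin

lemma sv_mul_abs_repr_le (M : Matrix (Fin d) (Fin d) ℝ) (v : E d) (k : Fin d) :
    sv M k * |(svBasis M).repr v k| ≤ ‖M.toEuclideanLin v‖ :=
  singularValues_mul_norm_repr_le M.toEuclideanLin finrank_euclideanSpace_fin v k

lemma abs_repr_le (b : OrthonormalBasis (Fin d) ℝ (E d)) (v : E d) (k : Fin d) :
    |b.repr v k| ≤ ‖v‖ := by
  rw [← b.repr.norm_map v, ← Real.norm_eq_abs]
  exact PiLp.norm_apply_le _ k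

lemma volume_norm_le_norm_apply_le {M : Matrix (Fin d) (Fin d) ℝ} (hM : IsUnit M) {C r : ℝ}
    (hC : 1 ≤ C) (hr : 0 < r) :
    volume {v : E d | ‖v‖ ≤ C ∧ ‖M.toEuclideanLin v‖ ≤ r}
      ≤ ENNReal.ofReal ((2 * C) ^ d * zFun M r) := by
  have hα : ∀ k : Fin d, 0 < sv M k := fun k => sv_pos hM k.2
  calc volume {v : E d | ‖v‖ ≤ C ∧ ‖M.toEuclideanLin v‖ ≤ r}
      ≤ volume {v : E d | ∀ k, |(svBasis M).repr v k| ≤ C * min (r / sv M k) 1} := by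
        refine measure_mono fun v hv k => ?_
        have hrepr : |(svBasis M).repr v k| ≤ r / sv M k := by
          rw [le_div_iff₀' (hα k)]
          exact (sv_mul_abs_repr_le M v k).trans hv.2
        rw [mul_min_of_nonneg _ _ (by linarith), mul_one]
        exact le_min (hrepr.trans (le_mul_of_one_le_left (div_pos hr (hα k)).le hC))
          ((abs_repr_le _ v k).trans hv.1)
    _ = ENNReal.ofReal (∏ k : Fin d, 2 * C * min (r / sv M k) 1) := by
        rw [volume_forall_abs_repr_le, ENNReal.ofReal_prod_of_nonneg]
        · simp_rw [mul_assoc]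
        · intro k _
          have := hα k
          positivity
    _ = ENNReal.ofReal ((2 * C) ^ d * zFun M r) := by
        rw [zFun_eq_prod hM, ← Fin.prod_univ_eq_prod_range (fun k => min (r / sv M k) 1) d,
          Finset.prod_mul_distrib]
        simp

lemma floor_div_mem_Icc {x R δ : ℝ} (hx : |x| ≤ R) (hδ : 0 < δ) :
    ⌊x / δ⌋ ∈ Finset.Icc (-⌈R / δ⌉) ⌈R / δ⌉ := by
  obtain ⟨hlower, hupper⟩ := abs_le.1 hx
  rw [Finset.mem_Icc, neg_le, ← Int.ceil_neg]
  refine ⟨Int.ceil_le_ceil ?_, (Int.floor_le_floor (by gcongr)).trans (Int.floor_le_ceil _)⟩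
  rw [← neg_div]
  gcongr
  linarith

lemma card_Icc_ceil_mul_min_le {L t : ℝ} (hL : 0 ≤ L) (ht : 0 < t) :
    ((Finset.Icc (-⌈L / t⌉) ⌈L / t⌉).card : ℝ) * min t 1 ≤ 2 * L + 3 := by
  have hceil : (0 : ℤ) ≤ ⌈L / t⌉ := Int.ceil_nonneg (by positivity)
  have hcard : ((Finset.Icc (-⌈L / t⌉) ⌈L / t⌉).card : ℝ) = 2 * ⌈L / t⌉ + 1 := by
    rw [Int.card_Icc]
    have h : (((⌈L / t⌉ + 1 - -⌈L / t⌉).toNat : ℤ) : ℝ) = 2 * ⌈L / t⌉ + 1 := by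
      rw [Int.toNat_of_nonneg (by omega)]
      push_cast
      ring
    exact_mod_cast h
  calc ((Finset.Icc (-⌈L / t⌉) ⌈L / t⌉).card : ℝ) * min t 1
      ≤ (2 * (L / t + 1) + 1) * min t 1 := by
        rw [hcard]
        gcongr
        exact (Int.ceil_lt_add_one _).le
    _ = 2 * (L / t * min t 1) + 3 * min t 1 := by ring
    _ ≤ 2 * (L / t * t) + 3 * 1 := by
        gcongr
        · exact min_le_left _ _
        · exact min_le_right _ _
    _ = 2 * L + 3 := by rw [div_mul_cancel₀ _ ht.ne', mul_one]

/-- The cell of `u` in the grid, adapted to the singular vectors of `M`, whose cells have images of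
diameter at most `r` under `M`. -/
def cellIndex (M : Matrix (Fin d) (Fin d) ℝ) (r : ℝ) (u : E d) (k : Fin d) : ℤ :=
  ⌊(svBasis M).repr u k / (r / (sv M k * d))⌋

lemma norm_sub_le_of_cellIndex_eq {M : Matrix (Fin d) (Fin d) ℝ} (hM : IsUnit M) {r : ℝ}
    (hr : 0 < r) {u u' : E d} (h : cellIndex M r u = cellIndex M r u') :
    ‖M.toEuclideanLin u - M.toEuclideanLin u'‖ ≤ r := by
  have hcoord : ∀ k : Fin d, sv M k * |(svBasis M).repr (u - u') k| ≤ r / d := by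
    intro k
    have hα : 0 < sv M k := sv_pos hM k.2
    have hd : (0 : ℝ) < d := by exact_mod_cast k.pos
    have hfloor := Int.abs_sub_lt_one_of_floor_eq_floor (congrFun h k)
    rw [← sub_div, abs_div, abs_of_pos (by positivity : 0 < r / (sv M k * d)),
      div_lt_one (by positivity), lt_div_iff₀ (by positivity)] at hfloor
    rw [le_div_iff₀ hd, map_sub]
    exact (le_of_eq (by rw [PiLp.sub_apply]; ring)).trans hfloor.le
  rw [← map_sub]
  calc ‖M.toEuclideanLin (u - u')‖ ≤ ∑ k : Fin d, sv M k * |(svBasis M).repr (u - u') k| :=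
        norm_apply_le_sum M.toEuclideanLin finrank_euclideanSpace_fin (u - u')
    _ ≤ ∑ _k : Fin d, r / d := Finset.sum_le_sum fun k _ => hcoord k
    _ = d * (r / d) := by simp
    _ ≤ r := by
        rw [mul_div_left_comm]
        exact mul_le_of_le_one_right hr.le (div_self_le_one _)

lemma exists_finset_cellIndex_mem {M : Matrix (Fin d) (Fin d) ℝ} (hM : IsUnit M) {R r : ℝ}
    (hR : 0 ≤ R) (hr : 0 < r) :
    ∃ F : Finset (Fin d → ℤ), (∀ u, ‖u‖ ≤ R → cellIndex M r u ∈ F) ∧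
      F.card * zFun M r ≤ (2 * (R * d) + 3) ^ d := by
  have hα : ∀ k : Fin d, 0 < sv M k := fun k => sv_pos hM k.2
  have hd (k : Fin d) : (0 : ℝ) < d := Nat.cast_pos.2 k.pos
  refine ⟨Fintype.piFinset fun k : Fin d =>
    Finset.Icc (-⌈R / (r / (sv M k * d))⌉) ⌈R / (r / (sv M k * d))⌉, fun u hu => ?_, ?_⟩
  · exact Fintype.mem_piFinset.2 fun k => floor_div_mem_Icc ((abs_repr_le _ u k).trans hu)
      (div_pos hr (mul_pos (hα k) (hd k)))
  · have hpow : ((2 * (R * d) + 3) ^ d : ℝ) = ∏ _k : Fin d, (2 * (R * d) + 3) := by simp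
    rw [Fintype.card_piFinset, zFun_eq_prod hM,
      ← Fin.prod_univ_eq_prod_range (fun k => min (r / sv M k) 1) d, Nat.cast_prod,
      ← Finset.prod_mul_distrib, hpow]
    refine Finset.prod_le_prod (fun k _ => ?_) fun k _ => ?_
    · have := hα k
      positivity
    · have hscale : R / (r / (sv M k * d)) = R * d / (r / sv M k) := by
        have := hα k
        have := hd k
        field_simp
      rw [hscale]
      exact card_Icc_ceil_mul_min_le (by positivity) (div_pos hr (hα k))

end Geometry

section Coding

variable {d m : ℕ} {T : Fin m → Matrix (Fin d) (Fin d) ℝ}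

/-- The contraction ratio of the system: the largest of the operator norms of the matrices. -/
def ratio (T : Fin m → Matrix (Fin d) (Fin d) ℝ) : ℝ :=
  ⨆ i, opNorm (T i)

lemma opNorm_le_ratio (T : Fin m → Matrix (Fin d) (Fin d) ℝ) (i : Fin m) :
    opNorm (T i) ≤ ratio T :=
  le_ciSup (f := fun i => opNorm (T i)) (Set.finite_range _).bddAbove i

lemma ratio_nonneg (T : Fin m → Matrix (Fin d) (Fin d) ℝ) : 0 ≤ ratio T :=
  Real.iSup_nonneg fun i => opNorm_nonneg (T i)

lemma ratio_lt_of_forall_opNorm_lt {c : ℝ} (hc : 0 < c) (h : ∀ i, opNorm (T i) < c) :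
    ratio T < c := by
  rcases isEmpty_or_nonempty (Fin m) with _ | _
  · rwa [ratio, Real.iSup_of_isEmpty]
  · obtain ⟨i, hi⟩ := exists_eq_ciSup_of_finite (f := fun i => opNorm (T i))
    exact hi.symm.trans_lt (h i)

lemma isUnit_wordMat (hT : ∀ i, IsUnit (T i)) (x : Shift m) (n : ℕ) : IsUnit (wordMat T x n) := by
  induction n with
  | zero => exact isUnit_one
  | succ n ih => exact ih.mul (hT _)

lemma opNorm_wordMat_le (T : Fin m → Matrix (Fin d) (Fin d) ℝ) (x : Shift m) (n : ℕ) :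
    opNorm (wordMat T x n) ≤ ratio T ^ n := by
  induction n with
  | zero => exact opNorm_one_le
  | succ n ih =>
    rw [wordMat, pow_succ]
    exact (opNorm_mul_le _ _).trans
      (mul_le_mul ih (opNorm_le_ratio T _) (opNorm_nonneg _) (pow_nonneg (ratio_nonneg T) n))

lemma wordMat_congr {x y : Shift m} {n : ℕ} (h : ∀ i < n, x i = y i) :
    wordMat T x n = wordMat T y n := by
  induction n with
  | zero => rfl
  | succ n ih => rw [wordMat, wordMat, ih fun i hi => h i (by omega), h n (by omega)]

lemma wordMat_add (T : Fin m → Matrix (Fin d) (Fin d) ℝ) (x : Shift m) (j k : ℕ) :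
    wordMat T x (j + k) = wordMat T x j * wordMat T (fun i => x (j + i)) k := by
  induction k with
  | zero => simp only [add_zero, wordMat, mul_one]
  | succ k ih => rw [← add_assoc, wordMat, wordMat, ih, mul_assoc]

/-- The `k`-th term `T_{x|k} a_{x k}` of the series representing the coding map. -/
def codingTerm (T : Fin m → Matrix (Fin d) (Fin d) ℝ) (a : Fin m → E d) (x : Shift m) (k : ℕ) :
    E d :=
  (wordMat T x k).toEuclideanLin (a (x k))

lemma wordMap_eq_sum_add (T : Fin m → Matrix (Fin d) (Fin d) ℝ) (a : Fin m → E d) (x : Shift m)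
    (n : ℕ) (v : E d) :
    wordMap T a x n v
      = ∑ k ∈ Finset.range n, codingTerm T a x k + (wordMat T x n).toEuclideanLin v := by
  induction n generalizing v with
  | zero => simp only [wordMap, id, Finset.range_zero, Finset.sum_empty, zero_add, wordMat,
      toEuclideanLin_one_apply]
  | succ n ih =>
    rw [wordMap, Function.comp_apply, ih, affMap, map_add, Finset.sum_range_succ, wordMat,
      toEuclideanLin_mul_apply, codingTerm]
    abel

lemma norm_codingTerm_le (T : Fin m → Matrix (Fin d) (Fin d) ℝ) (a : Fin m → E d) (x : Shift m)
    (k : ℕ) : ‖codingTerm T a x k‖ ≤ ratio T ^ k * ‖a (x k)‖ :=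
  (norm_toEuclideanLin_le _ _).trans
    (mul_le_mul_of_nonneg_right (opNorm_wordMat_le T x k) (norm_nonneg _))

lemma norm_codingTerm_le_mul_norm (T : Fin m → Matrix (Fin d) (Fin d) ℝ) (a : Fin m → E d)
    (x : Shift m) (k : ℕ) : ‖codingTerm T a x k‖ ≤ ratio T ^ k * ‖a‖ :=
  (norm_codingTerm_le T a x k).trans
    (mul_le_mul_of_nonneg_left (norm_le_pi_norm a (x k)) (pow_nonneg (ratio_nonneg T) k))

lemma summable_codingTerm (hT1 : ratio T < 1) (a : Fin m → E d) (x : Shift m) :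
    Summable (codingTerm T a x) :=
  .of_norm_bounded ((summable_geometric_of_lt_one (ratio_nonneg T) hT1).mul_right ‖a‖)
    (norm_codingTerm_le_mul_norm T a x)

lemma coding_eq_tsum (hT1 : ratio T < 1) (a : Fin m → E d) (x : Shift m) :
    coding T a x = ∑' k, codingTerm T a x k := by
  refine Tendsto.limUnder_eq ?_
  simp only [wordMap_eq_sum_add, map_zero, add_zero]
  exact (summable_codingTerm hT1 a x).hasSum.tendsto_sum_nat

lemma norm_coding_le (hT1 : ratio T < 1) (a : Fin m → E d) (x : Shift m) :
    ‖coding T a x‖ ≤ (1 - ratio T)⁻¹ * ‖a‖ := by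
  rw [coding_eq_tsum hT1]
  exact tsum_of_norm_bounded ((hasSum_geometric_of_lt_one (ratio_nonneg T) hT1).mul_right ‖a‖)
    (norm_codingTerm_le_mul_norm T a x)

lemma coding_sub (hT1 : ratio T < 1) (a b : Fin m → E d) (x : Shift m) :
    coding T (a - b) x = coding T a x - coding T b x := by
  rw [coding_eq_tsum hT1, coding_eq_tsum hT1, coding_eq_tsum hT1,
    ← (summable_codingTerm hT1 a x).tsum_sub (summable_codingTerm hT1 b x)]
  simp only [codingTerm, Pi.sub_apply, map_sub]

lemma coding_eq_sum_add (hT1 : ratio T < 1) (a : Fin m → E d) (x : Shift m) (n : ℕ) :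
    coding T a x = ∑ k ∈ Finset.range n, codingTerm T a x k +
      (wordMat T x n).toEuclideanLin (coding T a fun i => x (n + i)) := by
  have htail (k : ℕ) : codingTerm T a x (k + n)
      = Matrix.toEuclideanCLM (𝕜 := ℝ) (wordMat T x n) (codingTerm T a (fun i => x (n + i)) k) := by
    rw [codingTerm, add_comm k n, wordMat_add, toEuclideanLin_mul_apply]
    rfl
  rw [coding_eq_tsum hT1, coding_eq_tsum hT1,
    ← (summable_codingTerm hT1 a x).sum_add_tsum_nat_add n, tsum_congr htail,
    ← ContinuousLinearMap.map_tsum _ (summable_codingTerm hT1 a _)]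
  rfl

lemma coding_sub_coding (hT1 : ratio T < 1) (a : Fin m → E d) {x y : Shift m} {n : ℕ}
    (h : ∀ i < n, x i = y i) :
    coding T a x - coding T a y = (wordMat T x n).toEuclideanLin
      ((coding T a fun i => x (n + i)) - coding T a fun i => y (n + i)) := by
  have hsum : ∑ k ∈ Finset.range n, codingTerm T a x k
      = ∑ k ∈ Finset.range n, codingTerm T a y k := by
    refine Finset.sum_congr rfl fun k hk => ?_
    have hk := Finset.mem_range.1 hk
    rw [codingTerm, codingTerm, h k hk, wordMat_congr fun i hi => h i (hi.trans hk)]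
  rw [coding_eq_sum_add hT1 a x n, coding_eq_sum_add hT1 a y n, hsum, ← wordMat_congr h, map_sub,
    add_sub_add_left_eq_sub]

lemma isLocallyConstant_of_forall_lt_eq {α : Type*} {f : Shift m → α} (n : ℕ)
    (h : ∀ x y : Shift m, (∀ i < n, x i = y i) → f x = f y) : IsLocallyConstant f := by
  rw [IsLocallyConstant.iff_exists_open]
  intro x
  exact ⟨PiNat.cylinder x n, PiNat.isOpen_cylinder (fun _ => Fin m) x n,
    PiNat.self_mem_cylinder x n, fun y hy => h y x fun i hi => hy i hi⟩

lemma continuous_coding (hT1 : ratio T < 1) (a : Fin m → E d) : Continuous (coding T a) := by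
  rw [funext (coding_eq_tsum hT1 a)]
  refine continuous_tsum (fun k => (isLocallyConstant_of_forall_lt_eq (k + 1) ?_).continuous)
    ((summable_geometric_of_lt_one (ratio_nonneg T) hT1).mul_right ‖a‖)
    fun k x => norm_codingTerm_le_mul_norm T a x k
  intro x y h
  rw [codingTerm, codingTerm, h k (by omega), wordMat_congr fun i hi => h i (by omega)]

lemma lipschitzWith_coding (hT1 : ratio T < 1) (x : Shift m) :
    LipschitzWith (1 - ratio T)⁻¹.toNNReal fun a => coding T a x := by
  refine LipschitzWith.of_dist_le_mul fun a b => ?_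
  rw [dist_eq_norm, dist_eq_norm, ← coding_sub hT1,
    Real.coe_toNNReal _ (inv_nonneg.2 (by linarith))]
  exact norm_coding_le hT1 (a - b) x

lemma continuous_coding_prod (hT1 : ratio T < 1) :
    Continuous fun p : (Fin m → E d) × Shift m => coding T p.1 p.2 :=
  continuous_prod_of_continuous_lipschitzWith _ _ (fun a => continuous_coding hT1 a)
    fun x => lipschitzWith_coding hT1 x

end Coding

section Transversality

variable {d m : ℕ} {T : Fin m → Matrix (Fin d) (Fin d) ℝ}

/-- The weight `∑ ρ ^ k` over the positions `k ≥ 1` at which the letter `i` occurs in `x`. It bounds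
the contribution of these positions to the coding map when only `a_i` is varied. -/
def letterWeight (ρ : ℝ) (x : Shift m) (i : Fin m) : ℝ :=
  ∑' k : ℕ, ρ ^ (k + 1) * if x (k + 1) = i then 1 else 0

lemma summable_letterWeight {ρ : ℝ} (hρ0 : 0 ≤ ρ) (hρ1 : ρ < 1) (x : Shift m) (i : Fin m) :
    Summable fun k : ℕ => ρ ^ (k + 1) * if x (k + 1) = i then 1 else 0 := by
  refine .of_nonneg_of_le (fun k => by positivity) (fun k => ?_)
    ((summable_nat_add_iff 1).2 (summable_geometric_of_lt_one hρ0 hρ1))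
  exact mul_le_of_le_one_right (by positivity) (by split_ifs <;> norm_num)

lemma letterWeight_add_le {ρ : ℝ} (hρ0 : 0 ≤ ρ) (hρ1 : ρ < 1) (x : Shift m) {i j : Fin m}
    (hij : i ≠ j) : letterWeight ρ x i + letterWeight ρ x j ≤ ρ / (1 - ρ) := by
  have hi := summable_letterWeight hρ0 hρ1 x i
  have hj := summable_letterWeight hρ0 hρ1 x j
  have hg : HasSum (fun k : ℕ => ρ ^ (k + 1)) (ρ / (1 - ρ)) := by
    simpa only [pow_succ', div_eq_mul_inv] using (hasSum_geometric_of_lt_one hρ0 hρ1).mul_left ρ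
  rw [letterWeight, letterWeight, ← hi.tsum_add hj, ← hg.tsum_eq]
  refine (hi.add hj).tsum_le_tsum (fun k => ?_) hg.summable
  rw [← mul_add]
  refine mul_le_of_le_one_right (by positivity) ?_
  split_ifs with h h'
  · exact absurd (h.symm.trans h') hij
  all_goals norm_num

lemma norm_coding_single_sub_le (hT1 : ratio T < 1) (x : Shift m) (i : Fin m) (u : E d) :
    ‖coding T (Pi.single i u) x - (Pi.single i u : Fin m → E d) (x 0)‖
      ≤ letterWeight (ratio T) x i * ‖u‖ := by
  have hs := summable_codingTerm hT1 (Pi.single i u) x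
  have h0 : codingTerm T (Pi.single i u) x 0 = (Pi.single i u : Fin m → E d) (x 0) := by
    rw [codingTerm, wordMat, toEuclideanLin_one_apply]
  rw [coding_eq_tsum hT1, hs.tsum_eq_zero_add, h0, add_sub_cancel_left]
  refine tsum_of_norm_bounded
    ((summable_letterWeight (ratio_nonneg T) hT1 x i).hasSum.mul_right ‖u‖) fun k => ?_
  refine (norm_codingTerm_le T _ x (k + 1)).trans_eq ?_
  split_ifs with hk
  · rw [hk, Pi.single_eq_same, mul_one]
  · rw [Pi.single_eq_of_ne hk, norm_zero, mul_zero, zero_mul]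

lemma le_norm_coding_single_sub (hT1 : ratio T < 1) {x y : Shift m} {i : Fin m} (hx : x 0 = i)
    (hy : y 0 ≠ i) (u : E d) :
    (1 - (letterWeight (ratio T) x i + letterWeight (ratio T) y i)) * ‖u‖
      ≤ ‖coding T (Pi.single i u) x - coding T (Pi.single i u) y‖ := by
  have hxu := norm_coding_single_sub_le hT1 x i u
  have hyu := norm_coding_single_sub_le hT1 y i u
  rw [hx, Pi.single_eq_same, norm_sub_rev] at hxu
  rw [Pi.single_eq_of_ne hy, sub_zero] at hyu
  have hu := norm_add_le (u - coding T (Pi.single i u) x) (coding T (Pi.single i u) x)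
  have hxy := norm_sub_norm_le (coding T (Pi.single i u) x) (coding T (Pi.single i u) y)
  rw [sub_add_cancel] at hu
  linarith

/- The four weights of the letters `x 0` and `y 0` in `x` and in `y` add up to at most
`2 ρ / (1 - ρ)`, so that one of the two letters has weight at most `ρ / (1 - ρ)` in total. -/
lemma exists_le_norm_coding_single_sub (hT1 : ratio T < 1) {x y : Shift m} (hxy : x 0 ≠ y 0) :
    ∃ i, ∀ u : E d, (1 - ratio T / (1 - ratio T)) * ‖u‖
      ≤ ‖coding T (Pi.single i u) x - coding T (Pi.single i u) y‖ := by
  have hx := letterWeight_add_le (ratio_nonneg T) hT1 x hxy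
  have hy := letterWeight_add_le (ratio_nonneg T) hT1 y hxy
  rcases le_total (letterWeight (ratio T) x (x 0) + letterWeight (ratio T) y (x 0))
    (letterWeight (ratio T) x (y 0) + letterWeight (ratio T) y (y 0)) with h | h
  · refine ⟨x 0, fun u => le_trans ?_ (le_norm_coding_single_sub hT1 rfl hxy.symm u)⟩
    gcongr
    linarith
  · refine ⟨y 0, fun u => ?_⟩
    rw [norm_sub_rev]
    refine le_trans ?_ (le_norm_coding_single_sub hT1 rfl hxy u)
    gcongr
    linarith

lemma insertNth_sub_insertNth {α : Type*} [AddGroup α] (i : Fin (m + 1)) (v v' : α)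
    (w : Fin m → α) :
    (i.insertNth v w : Fin (m + 1) → α) - i.insertNth v' w = Pi.single i (v - v') := by
  rw [← Fin.insertNth_sub, sub_self, Fin.insertNth_zero_right]

lemma antilipschitzWith_coding_insertNth_sub {T : Fin (m + 1) → Matrix (Fin d) (Fin d) ℝ}
    (hT1 : ratio T < 1) {x y : Shift (m + 1)} {i : Fin (m + 1)} {c : ℝ} (hc : 0 < c)
    (h : ∀ u : E d, c * ‖u‖ ≤ ‖coding T (Pi.single i u) x - coding T (Pi.single i u) y‖)
    (w : Fin m → E d) :
    AntilipschitzWith c⁻¹.toNNReal fun v : E d =>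
      coding T (i.insertNth v w) x - coding T (i.insertNth v w) y := by
  refine AntilipschitzWith.of_le_mul_dist fun v v' => ?_
  rw [dist_eq_norm, dist_eq_norm, Real.coe_toNNReal _ (by positivity), sub_sub_sub_comm,
    ← coding_sub hT1, ← coding_sub hT1, insertNth_sub_insertNth, ← div_eq_inv_mul,
    le_div_iff₀' hc]
  exact h (v - v')

lemma volume_slice_le {T : Fin (m + 1) → Matrix (Fin d) (Fin d) ℝ} (hT : ∀ i, IsUnit (T i))
    (hT1 : ratio T < 1) {R : ℝ} (hR : 1 ≤ R) {x y : Shift (m + 1)} {n : ℕ}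
    (hxy : ∀ i < n, x i = y i) {i : Fin (m + 1)} {c : ℝ} (hc : 0 < c)
    (h : ∀ u : E d, c * ‖u‖ ≤
      ‖(coding T (Pi.single i u) fun i => x (n + i)) - coding T (Pi.single i u) fun i => y (n + i)‖)
    {r : ℝ} (hr : 0 < r) (w : Fin m → E d) :
    volume {v : E d | (i.insertNth v w : Fin (m + 1) → E d) ∈ Metric.closedBall 0 R ∧
        ‖coding T (i.insertNth v w) x - coding T (i.insertNth v w) y‖ ≤ r}
      ≤ c⁻¹.toNNReal ^ d *
        ENNReal.ofReal ((2 * (2 * ((1 - ratio T)⁻¹ * R))) ^ d * zFun (wordMat T x n) r) := by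
  have hinv : 1 ≤ (1 - ratio T)⁻¹ :=
    (one_le_inv₀ (by linarith)).2 (by linarith [ratio_nonneg T])
  have hg := volume_preimage_le_of_antilipschitzWith rfl
    (antilipschitzWith_coding_insertNth_sub hT1 hc h w)
    {v | ‖v‖ ≤ 2 * ((1 - ratio T)⁻¹ * R) ∧ ‖(wordMat T x n).toEuclideanLin v‖ ≤ r}
  rw [finrank_euclideanSpace_fin] at hg
  refine (measure_mono ?_).trans (hg.trans ?_)
  · rintro v ⟨hv, hvr⟩
    rw [coding_sub_coding hT1 _ hxy] at hvr
    refine ⟨(norm_sub_le _ _).trans ?_, hvr⟩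
    have hcod (z : Shift (m + 1)) : ‖coding T (i.insertNth v w) z‖ ≤ (1 - ratio T)⁻¹ * R :=
      (norm_coding_le hT1 _ z).trans
        (mul_le_mul_of_nonneg_left (mem_closedBall_zero_iff.1 hv) (by linarith))
    linarith [hcod fun i => x (n + i), hcod fun i => y (n + i)]
  · gcongr
    exact volume_norm_le_norm_apply_le (isUnit_wordMat hT x n) (by nlinarith) hr

lemma volume_insertNth_slices_le {F : Type*} [NormedAddCommGroup F] [MeasureSpace F]
    [SigmaFinite (volume : Measure F)] (i : Fin (m + 1)) {R : ℝ}
    {s : Set (Fin (m + 1) → F)} (hs : MeasurableSet s) (hsR : s ⊆ Metric.closedBall 0 R)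
    (hm : MeasurableSet (Metric.closedBall (0 : Fin m → F) R))
    {c : ℝ≥0∞} (h : ∀ w : Fin m → F, volume {v : F | (i.insertNth v w : Fin (m + 1) → F) ∈ s} ≤ c) :
    volume s ≤ c * volume (Metric.closedBall (0 : Fin m → F) R) := by
  have hmp := (volume_preserving_piFinSuccAbove (fun _ : Fin (m + 1) => F) i).symm
  rw [← hmp.measure_preimage_equiv, Measure.volume_eq_prod,
    Measure.prod_apply_symm (hs.preimage (MeasurableEquiv.measurable _)),
    ← lintegral_indicator_const hm]
  refine lintegral_mono fun w => ?_
  by_cases hw : w ∈ Metric.closedBall 0 R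
  · rw [Set.indicator_of_mem hw]
    exact h w
  · rw [Set.indicator_of_notMem hw, nonpos_iff_eq_zero]
    refine measure_mono_null (t := ∅) (fun v hv => hw ?_) measure_empty
    have hvw := hsR hv
    rw [mem_closedBall_zero_iff] at hvw ⊢
    refine (pi_norm_le_iff_of_nonneg ((norm_nonneg _).trans hvw)).2 fun k => ?_
    have := (norm_le_pi_norm _ (i.succAbove k)).trans hvw
    change ‖(i.insertNth v w : Fin (m + 1) → F) (i.succAbove k)‖ ≤ R at this
    rwa [Fin.insertNth_apply_succAbove] at this

lemma exists_volume_coding_sub_le (hT : ∀ i, IsUnit (T i)) (hT2 : ratio T < 1 / 2) {R : ℝ}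
    (hR : 1 ≤ R) :
    ∃ C : ℝ≥0∞, C ≠ ∞ ∧ ∀ (x y : Shift m) (n : ℕ), (∀ i < n, x i = y i) → x n ≠ y n →
      ∀ r, 0 < r → volume {a ∈ Metric.closedBall 0 R | ‖coding T a x - coding T a y‖ ≤ r}
        ≤ C * ENNReal.ofReal (zFun (wordMat T x n) r) := by
  rcases m with _ | m
  · exact ⟨0, ENNReal.zero_ne_top, fun x => (x 0).elim0⟩
  have hT1 : ratio T < 1 := by linarith
  have hc : 0 < 1 - ratio T / (1 - ratio T) := by
    rw [sub_pos, div_lt_one (by linarith)]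
    linarith
  set c := 1 - ratio T / (1 - ratio T)
  refine ⟨c⁻¹.toNNReal ^ d * ENNReal.ofReal ((2 * (2 * ((1 - ratio T)⁻¹ * R))) ^ d)
    * volume (Metric.closedBall (0 : Fin m → E d) R),
    ENNReal.mul_ne_top (by finiteness) measure_closedBall_lt_top.ne, fun x y n hxy hn r hr => ?_⟩
  obtain ⟨i, hi⟩ := exists_le_norm_coding_single_sub (x := fun i => x (n + i))
    (y := fun i => y (n + i)) hT1 hn
  have hcod (z : Shift (m + 1)) : Measurable fun a => coding T a z :=
    (lipschitzWith_coding hT1 z).continuous.measurable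
  have hmeas : MeasurableSet {a ∈ Metric.closedBall 0 R | ‖coding T a x - coding T a y‖ ≤ r} :=
    measurableSet_closedBall.inter
      (measurableSet_le ((hcod x).sub (hcod y)).norm measurable_const)
  refine (volume_insertNth_slices_le i hmeas (Set.sep_subset _ _) measurableSet_closedBall
    (volume_slice_le hT hT1 hR hxy hc hi hr)).trans_eq ?_
  rw [ENNReal.ofReal_mul' (zFun_nonneg _ hr.le)]
  ring

end Transversality

section Potential

variable {d m : ℕ} {T : Fin m → Matrix (Fin d) (Fin d) ℝ} {μ : Measure (Shift m)}

lemma mem_cyl {x y : Shift m} {n : ℕ} : y ∈ cyl x n ↔ ∀ i < n, y i = x i := Iff.rfl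

lemma self_mem_cyl (x : Shift m) (n : ℕ) : x ∈ cyl x n := fun _ _ => rfl

lemma isOpen_cyl (x : Shift m) (n : ℕ) : IsOpen (cyl x n) :=
  PiNat.isOpen_cylinder (fun _ => Fin m) x n

lemma measurableSet_cyl (x : Shift m) (n : ℕ) : MeasurableSet (cyl x n) :=
  (isOpen_cyl x n).measurableSet

lemma cyl_congr {x y : Shift m} {n : ℕ} (h : ∀ i < n, x i = y i) : cyl x n = cyl y n := by
  ext z
  rw [mem_cyl, mem_cyl]
  exact forall₂_congr fun i hi => by rw [h i hi]

lemma Z_self (T : Fin m → Matrix (Fin d) (Fin d) ℝ) (x : Shift m) (r : ℝ) : Z T x x r = 1 :=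
  if_pos rfl

lemma Z_of_ne (T : Fin m → Matrix (Fin d) (Fin d) ℝ) {x y : Shift m} (h : x ≠ y) (r : ℝ) :
    Z T x y r = zFun (wordMat T x (PiNat.firstDiff (E := fun _ => Fin m) x y)) r :=
  if_neg h

lemma Z_eq_zFun {x y : Shift m} {j : ℕ} (h : ∀ i < j, x i = y i) (hne : x j ≠ y j) (r : ℝ) :
    Z T x y r = zFun (wordMat T x j) r := by
  have hxy : x ≠ y := fun h => hne (congrFun h j)
  have hj : PiNat.firstDiff (E := fun _ => Fin m) x y = j := by
    refine le_antisymm (not_lt.1 fun hlt => ?_) (not_lt.1 fun hlt => ?_)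
    · exact hne (PiNat.apply_eq_of_lt_firstDiff hlt)
    · exact PiNat.apply_firstDiff_ne hxy (h _ hlt)
  rw [Z_of_ne T hxy, hj]

lemma Z_cases (T : Fin m → Matrix (Fin d) (Fin d) ℝ) (x y : Shift m) (r : ℝ) :
    x = y ∧ Z T x y r = 1 ∨
      ∃ j, (∀ i < j, x i = y i) ∧ x j ≠ y j ∧ Z T x y r = zFun (wordMat T x j) r := by
  by_cases h : x = y
  · exact .inl ⟨h, h ▸ Z_self T x r⟩
  · exact .inr ⟨_, fun i hi => PiNat.apply_eq_of_lt_firstDiff hi, PiNat.apply_firstDiff_ne h,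
      Z_of_ne T h r⟩

lemma Z_nonneg (T : Fin m → Matrix (Fin d) (Fin d) ℝ) (x y : Shift m) {r : ℝ} (hr : 0 ≤ r) :
    0 ≤ Z T x y r := by
  unfold Z
  split_ifs
  · exact zero_le_one
  · exact zFun_nonneg _ hr

lemma Z_le_one (T : Fin m → Matrix (Fin d) (Fin d) ℝ) (x y : Shift m) {r : ℝ} (hr : 0 ≤ r) :
    Z T x y r ≤ 1 := by
  unfold Z
  split_ifs
  · exact le_rfl
  · exact zFun_le_one _ hr

lemma Z_mono (T : Fin m → Matrix (Fin d) (Fin d) ℝ) (x y : Shift m) {r r' : ℝ} (hr : 0 ≤ r)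
    (h : r ≤ r') : Z T x y r ≤ Z T x y r' := by
  unfold Z
  split_ifs
  · exact le_rfl
  · exact zFun_mono _ hr h

lemma Z_mul_le (T : Fin m → Matrix (Fin d) (Fin d) ℝ) (x y : Shift m) {c r : ℝ} (hc : 1 ≤ c)
    (hr : 0 ≤ r) : Z T x y (c * r) ≤ c ^ d * Z T x y r := by
  unfold Z
  split_ifs
  · exact (one_le_pow₀ hc).trans_eq (mul_one _).symm
  · exact zFun_mul_le _ hc hr

lemma opNorm_wordMat_le_one (hT1 : ratio T ≤ 1) (x : Shift m) (n : ℕ) :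
    opNorm (wordMat T x n) ≤ 1 :=
  (opNorm_wordMat_le T x n).trans (pow_le_one₀ (ratio_nonneg T) hT1)

lemma pow_le_Z (hT : ∀ i, IsUnit (T i)) (hT1 : ratio T ≤ 1) (x y : Shift m) {r : ℝ} (hr : 0 ≤ r)
    (hr1 : r ≤ 1) : r ^ d ≤ Z T x y r := by
  unfold Z
  split_ifs
  · exact pow_le_one₀ hr hr1
  · exact pow_le_zFun (isUnit_wordMat hT _ _) (opNorm_wordMat_le_one hT1 _ _) hr hr1

lemma zFun_wordMat_le_Z (hT : ∀ i, IsUnit (T i)) (hT1 : ratio T ≤ 1) {x y : Shift m} {j : ℕ}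
    (hy : y ∈ cyl x j) {r : ℝ} (hr : 0 ≤ r) : zFun (wordMat T x j) r ≤ Z T x y r := by
  rcases eq_or_ne x y with rfl | hxy
  · exact (zFun_le_one _ hr).trans_eq (Z_self T x r).symm
  · obtain ⟨k, hk⟩ := Nat.exists_eq_add_of_le
      ((PiNat.mem_cylinder_iff_le_firstDiff (E := fun _ => Fin m) hxy.symm j).1 hy)
    rw [Z_of_ne T hxy, PiNat.firstDiff_comm, hk, wordMat_add]
    exact zFun_le_zFun_mul (isUnit_wordMat hT _ _) (isUnit_wordMat hT _ _)
      (opNorm_wordMat_le_one hT1 _ _) hr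

lemma exists_le_mem_cyl_Z_eq_zFun (hT : ∀ i, IsUnit (T i)) (hT1 : ratio T ≤ 1) (x y : Shift m)
    {n : ℕ} {r : ℝ} (hn : ratio T ^ n ≤ r) :
    ∃ j ≤ n, y ∈ cyl x j ∧ Z T x y r = zFun (wordMat T x j) r := by
  have hr : 0 ≤ r := (pow_nonneg (ratio_nonneg T) n).trans hn
  by_cases hy : y ∈ cyl x n
  · have hone : zFun (wordMat T x n) r = 1 :=
      zFun_eq_one (isUnit_wordMat hT x n) ((opNorm_wordMat_le T x n).trans hn)
    refine ⟨n, le_rfl, hy, le_antisymm ?_ (zFun_wordMat_le_Z hT hT1 hy hr)⟩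
    exact (Z_le_one T x y hr).trans_eq hone.symm
  · rcases Z_cases T x y r with ⟨rfl, -⟩ | ⟨j, hj, -, hZ⟩
    · exact absurd (self_mem_cyl x n) hy
    · refine ⟨j, ?_, fun i hi => (hj i hi).symm, hZ⟩
      exact not_lt.1 fun hnj => hy fun i hi => (hj i (hi.trans hnj)).symm

lemma continuousAt_Z {x y : Shift m} (hxy : x ≠ y) (r : ℝ) :
    ContinuousAt (fun p : Shift m × Shift m => Z T p.1 p.2 r) (x, y) := by
  set j := PiNat.firstDiff (E := fun _ => Fin m) x y
  have hj : x j ≠ y j := PiNat.apply_firstDiff_ne hxy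
  refine (continuousAt_const (y := Z T x y r)).congr ?_
  filter_upwards [((isOpen_cyl x (j + 1)).prod (isOpen_cyl y (j + 1))).mem_nhds
    ⟨self_mem_cyl x _, self_mem_cyl y _⟩] with ⟨x', y'⟩ hp
  have hx' : ∀ i < j + 1, x' i = x i := hp.1
  have hy' : ∀ i < j + 1, y' i = y i := hp.2
  have hxy' : ∀ i < j, x' i = y' i := fun i hi => by
    rw [hx' i (by omega), hy' i (by omega)]
    exact PiNat.apply_eq_of_lt_firstDiff hi
  rw [Z_of_ne T hxy, Z_eq_zFun hxy' (by rwa [hx' j (by omega), hy' j (by omega)]),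
    wordMat_congr fun i hi => hx' i (by omega)]

lemma measurable_Z (T : Fin m → Matrix (Fin d) (Fin d) ℝ) (r : ℝ) :
    Measurable fun p : Shift m × Shift m => Z T p.1 p.2 r := by
  classical
  have hdiag : (fun p : Shift m × Shift m => Z T p.1 p.2 r)
      = (Set.diagonal (Shift m)).piecewise (fun _ => 1) fun p => Z T p.1 p.2 r := by
    ext ⟨x, y⟩
    by_cases h : x = y
    · rw [Set.piecewise_eq_of_mem _ _ _ (Set.mem_diagonal_iff.2 h), h, Z_self]
    · rw [Set.piecewise_eq_of_notMem _ _ _ (mt Set.mem_diagonal_iff.1 h)]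
  rw [hdiag]
  exact ContinuousOn.measurable_piecewise continuousOn_const
    (fun p hp => (continuousAt_Z hp r).continuousWithinAt) isClosed_diagonal.measurableSet

lemma integrable_Z [IsFiniteMeasure μ] (x : Shift m) {r : ℝ} (hr : 0 ≤ r) :
    Integrable (fun y => Z T x y r) μ := by
  refine .of_bound ((measurable_Z T r).comp measurable_prodMk_left).aestronglyMeasurable 1
    (ae_of_all _ fun y => ?_)
  rw [Real.norm_of_nonneg (Z_nonneg T x y hr)]
  exact Z_le_one T x y hr

lemma measurable_G [SFinite μ] (r : ℝ) : Measurable fun x => G T μ x r :=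
  (measurable_Z T r).stronglyMeasurable.integral_prod_right.measurable

lemma ofReal_G [IsFiniteMeasure μ] (x : Shift m) {r : ℝ} (hr : 0 ≤ r) :
    ENNReal.ofReal (G T μ x r) = ∫⁻ y, ENNReal.ofReal (Z T x y r) ∂μ :=
  ofReal_integral_eq_lintegral_ofReal (integrable_Z x hr) (ae_of_all _ fun y => Z_nonneg T x y hr)

lemma G_mono [IsFiniteMeasure μ] (x : Shift m) {r r' : ℝ} (hr : 0 ≤ r) (h : r ≤ r') :
    G T μ x r ≤ G T μ x r' :=
  integral_mono (integrable_Z x hr) (integrable_Z x (hr.trans h)) fun y => Z_mono T x y hr h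

lemma G_mul_le [IsFiniteMeasure μ] (x : Shift m) {c r : ℝ} (hc : 1 ≤ c) (hr : 0 ≤ r) :
    G T μ x (c * r) ≤ c ^ d * G T μ x r := by
  rw [G, G, ← integral_const_mul]
  exact integral_mono (integrable_Z x (by positivity)) ((integrable_Z x hr).const_mul _)
    fun y => Z_mul_le T x y hc hr

lemma measureReal_cyl_mul_zFun_le_G [IsFiniteMeasure μ] (hT : ∀ i, IsUnit (T i))
    (hT1 : ratio T ≤ 1) (x : Shift m) (j : ℕ) {r : ℝ} (hr : 0 ≤ r) :
    μ.real (cyl x j) * zFun (wordMat T x j) r ≤ G T μ x r := by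
  rw [← smul_eq_mul, ← integral_indicator_const _ (measurableSet_cyl x j)]
  exact integral_mono ((integrable_const _).indicator (measurableSet_cyl x j)) (integrable_Z x hr)
    (Set.indicator_le' (fun y hy => zFun_wordMat_le_Z hT hT1 hy hr) fun y _ => Z_nonneg T x y hr)

lemma G_le_sum [IsFiniteMeasure μ] (hT : ∀ i, IsUnit (T i)) (hT1 : ratio T ≤ 1) (x : Shift m)
    {n : ℕ} {r : ℝ} (hn : ratio T ^ n ≤ r) :
    G T μ x r ≤ ∑ j ∈ Finset.range (n + 1), μ.real (cyl x j) * zFun (wordMat T x j) r := by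
  have hr : 0 ≤ r := (pow_nonneg (ratio_nonneg T) n).trans hn
  have hint (j : ℕ) : Integrable ((cyl x j).indicator fun _ => zFun (wordMat T x j) r) μ :=
    (integrable_const _).indicator (measurableSet_cyl x j)
  simp_rw [← smul_eq_mul, ← integral_indicator_const _ (measurableSet_cyl x _)]
  rw [← integral_finsetSum _ fun j _ => hint j]
  refine integral_mono (integrable_Z x hr) (integrable_finsetSum _ fun j _ => hint j) fun y => ?_
  obtain ⟨j, hj, hy, hZ⟩ := exists_le_mem_cyl_Z_eq_zFun hT hT1 x y hn
  dsimp only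
  rw [hZ, ← Set.indicator_of_mem hy fun _ => zFun (wordMat T x j) r]
  exact Finset.single_le_sum
    (f := fun j => (cyl x j).indicator (fun _ => zFun (wordMat T x j) r) y)
    (fun j _ => Set.indicator_nonneg (fun _ _ => zFun_nonneg _ hr) y)
    (Finset.mem_range_succ_iff.2 hj)

variable [IsProbabilityMeasure μ]

lemma G_le_one (x : Shift m) {r : ℝ} (hr : 0 ≤ r) : G T μ x r ≤ 1 :=
  (integral_mono (integrable_Z x hr) (integrable_const 1) fun y => Z_le_one T x y hr).trans_eq
    (by simp)

lemma pow_le_G (hT : ∀ i, IsUnit (T i)) (hT1 : ratio T ≤ 1) (x : Shift m) {r : ℝ} (hr : 0 ≤ r)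
    (hr1 : r ≤ 1) : r ^ d ≤ G T μ x r := by
  refine le_trans ?_ (integral_mono (integrable_const (r ^ d)) (integrable_Z x hr)
    fun y => pow_le_Z hT hT1 x y hr hr1)
  simp

lemma G_pos (hT : ∀ i, IsUnit (T i)) (hT1 : ratio T ≤ 1) (x : Shift m) {r : ℝ} (hr : 0 < r) :
    0 < G T μ x r :=
  calc 0 < min r 1 ^ d := pow_pos (lt_min hr one_pos) d
    _ ≤ G T μ x (min r 1) := pow_le_G hT hT1 x (by positivity) (min_le_right r 1)
    _ ≤ G T μ x r := G_mono x (by positivity) (min_le_left r 1)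

end Potential

section BorelCantelli

lemma summable_inv_natCast_add_one_sq : Summable fun n : ℕ => (((n : ℝ) + 1) ^ 2)⁻¹ := by
  simpa only [Nat.cast_add, Nat.cast_one] using
    (summable_nat_add_iff 1).2 (Real.summable_nat_pow_inv.2 one_lt_two)

lemma ae_eventually_notMem_of_summable {α : Type*} [MeasurableSpace α] {μ : Measure α}
    [IsFiniteMeasure μ] {s : ℕ → Set α} (h : Summable fun n => μ.real (s n)) :
    ∀ᵐ x ∂μ, ∀ᶠ n in atTop, x ∉ s n := by
  refine ae_eventually_notMem ?_
  rw [← tsum_congr fun n => ofReal_measureReal (μ := μ) (s := s n)]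
  exact h.tsum_ofReal_ne_top

lemma ae_eventually_le_one_of_tsum_lintegral_ne_top {α : Type*} [MeasurableSpace α]
    {μ : Measure α} {f : ℕ → α → ℝ≥0∞} (hf : ∀ n, AEMeasurable (f n) μ)
    (h : ∑' n, ∫⁻ x, f n x ∂μ ≠ ∞) : ∀ᵐ x ∂μ, ∀ᶠ n in atTop, f n x ≤ 1 := by
  rw [← lintegral_tsum hf] at h
  filter_upwards [ae_lt_top' (.tsum hf) h] with x hx
  exact (ENNReal.tendsto_atTop_zero_of_tsum_ne_top hx.ne).eventually_le_const one_pos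

lemma ae_ae_eventually_mul_le_of_lintegral_le {α β : Type*} [MeasurableSpace α]
    [MeasurableSpace β] {ν : Measure α} {μ : Measure β} [SFinite ν] [IsFiniteMeasure μ]
    {f : ℕ → α × β → ℝ≥0∞} {g : ℕ → β → ℝ≥0∞} {w : ℕ → ℝ≥0∞} (hf : ∀ n, Measurable (f n))
    (hg : ∀ n, Measurable (g n)) (hg0 : ∀ n x, g n x ≠ 0) (hg1 : ∀ n x, g n x ≠ ∞)
    (hw : ∑' n, w n ≠ ∞) {C : ℝ≥0∞} (hC : C ≠ ∞)
    (hfg : ∀ n x, ∫⁻ a, f n (a, x) ∂ν ≤ C * g n x) :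
    ∀ᵐ a ∂ν, ∀ᵐ x ∂μ, ∀ᶠ n in atTop, w n * f n (a, x) ≤ g n x := by
  let F (n : ℕ) (p : α × β) : ℝ≥0∞ := (g n p.2)⁻¹ * (w n * f n p)
  have hF (n : ℕ) : Measurable (F n) :=
    ((hg n).comp measurable_snd).inv.mul ((hf n).const_mul _)
  have hint (n : ℕ) : ∫⁻ p, F n p ∂(ν.prod μ) ≤ w n * (C * μ Set.univ) := by
    have hfx (x : β) : Measurable fun a => f n (a, x) := (hf n).comp measurable_prodMk_right
    have hslice (x : β) : ∫⁻ a, F n (a, x) ∂ν ≤ w n * C := calc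
      ∫⁻ a, F n (a, x) ∂ν = (g n x)⁻¹ * (w n * ∫⁻ a, f n (a, x) ∂ν) := by
        rw [← lintegral_const_mul _ (hfx x), ← lintegral_const_mul _ ((hfx x).const_mul _)]
      _ ≤ (g n x)⁻¹ * (w n * (C * g n x)) := by gcongr; exact hfg n x
      _ = w n * C * ((g n x)⁻¹ * g n x) := by ring
      _ = w n * C := by rw [ENNReal.inv_mul_cancel (hg0 n x) (hg1 n x), mul_one]
    rw [lintegral_prod_symm _ (hF n).aemeasurable, ← mul_assoc, ← lintegral_const]
    exact lintegral_mono hslice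
  have hsum : ∑' n, ∫⁻ p, F n p ∂(ν.prod μ) ≠ ∞ := by
    refine ne_top_of_le_ne_top ?_ (ENNReal.tsum_le_tsum hint)
    rw [ENNReal.tsum_mul_right]
    finiteness
  filter_upwards [Measure.ae_ae_of_ae_prod (ae_eventually_le_one_of_tsum_lintegral_ne_top
    (fun n => (hF n).aemeasurable) hsum)] with a ha
  filter_upwards [ha] with x hx
  filter_upwards [hx] with n hn
  simpa only [mul_one] using (ENNReal.inv_mul_le_iff (hg0 n x) (hg1 n x)).1 hn

end BorelCantelli

section Estimates

variable {d m : ℕ} {T : Fin m → Matrix (Fin d) (Fin d) ℝ} {μ : Measure (Shift m)}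

/-- The set of the points `y` whose images under the coding map lie within distance `r` of the
image of `x`: the preimage under `π^a` of the closed ball `B(π^a(x), r)`. -/
def near (T : Fin m → Matrix (Fin d) (Fin d) ℝ) (a : Fin m → E d) (x : Shift m) (r : ℝ) :
    Set (Shift m) :=
  {y | ‖coding T a x - coding T a y‖ ≤ r}

lemma near_mono (T : Fin m → Matrix (Fin d) (Fin d) ℝ) (a : Fin m → E d) (x : Shift m)
    {r r' : ℝ} (h : r ≤ r') : near T a x r ⊆ near T a x r' :=
  fun _ hy => le_trans hy h

lemma measurableSet_setOf_mem_near (hT1 : ratio T < 1) (r : ℝ) :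
    MeasurableSet {p : ((Fin m → E d) × Shift m) × Shift m | p.2 ∈ near T p.1.1 p.1.2 r} := by
  have h := (continuous_coding_prod hT1).measurable
  refine measurableSet_le (Measurable.norm (Measurable.sub ?_ ?_)) measurable_const
  · exact h.comp measurable_fst
  · exact h.comp ((measurable_fst.comp measurable_fst).prodMk measurable_snd)

lemma measurable_measure_near [SFinite μ] (hT1 : ratio T < 1) (r : ℝ) :
    Measurable fun p : (Fin m → E d) × Shift m => μ (near T p.1 p.2 r) :=
  measurable_measure_prodMk_left (measurableSet_setOf_mem_near hT1 r)

lemma lintegral_measure_near [SFinite μ] (hT1 : ratio T < 1) (ν : Measure (Fin m → E d))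
    [SFinite ν] (x : Shift m) (r : ℝ) :
    ∫⁻ a, μ (near T a x r) ∂ν = ∫⁻ y, ν {a | y ∈ near T a x r} ∂μ := by
  have hm : MeasurableSet {p : (Fin m → E d) × Shift m | p.2 ∈ near T p.1 x r} :=
    (by fun_prop : Measurable fun p : (Fin m → E d) × Shift m => ((p.1, x), p.2))
      (measurableSet_setOf_mem_near hT1 r)
  exact (Measure.prod_apply hm).symm.trans (Measure.prod_apply_symm hm)

lemma exists_volume_mem_near_le (hT : ∀ i, IsUnit (T i)) (hT2 : ratio T < 1 / 2) {R : ℝ}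
    (hR : 1 ≤ R) :
    ∃ C : ℝ≥0∞, C ≠ ∞ ∧ ∀ (x y : Shift m) (r : ℝ), 0 < r →
      volume {a ∈ Metric.closedBall (0 : Fin m → E d) R | y ∈ near T a x r}
        ≤ C * ENNReal.ofReal (Z T x y r) := by
  obtain ⟨C, hC, hvol⟩ := exists_volume_coding_sub_le hT hT2 hR
  refine ⟨max C (volume (Metric.closedBall (0 : Fin m → E d) R)),
    (max_lt hC.lt_top measure_closedBall_lt_top).ne, fun x y r hr => ?_⟩
  rcases Z_cases T x y r with ⟨-, hZ⟩ | ⟨j, hj, hne, hZ⟩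
  · rw [hZ, ENNReal.ofReal_one, mul_one]
    exact (measure_mono (Set.sep_subset _ _)).trans (le_max_right _ _)
  · rw [hZ]
    exact (hvol x y j hj hne r hr).trans (by gcongr; exact le_max_left _ _)

lemma exists_lintegral_near_le [IsFiniteMeasure μ] (hT : ∀ i, IsUnit (T i))
    (hT2 : ratio T < 1 / 2) {R : ℝ} (hR : 1 ≤ R) :
    ∃ C : ℝ≥0∞, C ≠ ∞ ∧ ∀ (x : Shift m) (r : ℝ), 0 < r →
      ∫⁻ a in Metric.closedBall 0 R, μ (near T a x r) ≤ C * ENNReal.ofReal (G T μ x r) := by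
  obtain ⟨C, hC, hvol⟩ := exists_volume_mem_near_le hT hT2 hR
  refine ⟨C, hC, fun x r hr => ?_⟩
  rw [lintegral_measure_near (hT2.trans (by norm_num)), ofReal_G x hr.le,
    ← lintegral_const_mul' _ _ hC]
  refine lintegral_mono fun y => ?_
  rw [Measure.restrict_apply' measurableSet_closedBall, Set.inter_comm]
  exact hvol x y r hr

lemma ae_ae_eventually_measure_near_le [IsProbabilityMeasure μ] (hT : ∀ i, IsUnit (T i))
    (hT2 : ratio T < 1 / 2) :
    ∀ᵐ a : Fin m → E d, ∀ᵐ x ∂μ, ∀ᶠ n : ℕ in atTop,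
      μ.real (near T a x ((1 / 2) ^ n)) ≤ ((n : ℝ) + 1) ^ 2 * G T μ x ((1 / 2) ^ n) := by
  have hT1 : ratio T < 1 := hT2.trans (by norm_num)
  have hGpos (n : ℕ) (x : Shift m) : 0 < G T μ x ((1 / 2) ^ n) :=
    G_pos hT hT1.le x (by positivity)
  have hcover : ⋃ N : ℕ, Metric.closedBall (0 : Fin m → E d) (N + 1) = Set.univ :=
    Set.eq_univ_of_forall fun a => Set.mem_iUnion.2 <|
      (exists_nat_ge ‖a‖).imp fun N hN => mem_closedBall_zero_iff.2 (by linarith)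
  rw [← Measure.restrict_univ (μ := (volume : Measure (Fin m → E d))), ← hcover,
    ae_restrict_iUnion_iff]
  intro N
  obtain ⟨C, hC, hint⟩ := exists_lintegral_near_le (μ := μ) hT hT2 (R := N + 1) (by simp)
  filter_upwards [ae_ae_eventually_mul_le_of_lintegral_le (μ := μ)
    (f := fun n (p : (Fin m → E d) × Shift m) => μ (near T p.1 p.2 ((1 / 2) ^ n)))
    (fun n => measurable_measure_near hT1 _) (fun n => (measurable_G _).ennreal_ofReal)
    (fun n x => (ENNReal.ofReal_pos.2 (hGpos n x)).ne') (fun n x => ENNReal.ofReal_ne_top)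
    summable_inv_natCast_add_one_sq.tsum_ofReal_ne_top hC
    fun n x => hint x _ (by positivity)] with a ha
  filter_upwards [ha] with x hx
  filter_upwards [hx] with n hn
  rw [← ofReal_measureReal, ← ENNReal.ofReal_mul (by positivity),
    ENNReal.ofReal_le_ofReal_iff (hGpos n x).le] at hn
  exact (inv_mul_le_iff₀ (by positivity)).1 hn

lemma measureReal_le_sum_inter_preimage {α β : Type*} [MeasurableSpace α] {μ : Measure α}
    [IsFiniteMeasure μ] {s : Set α} {f : α → β} {F : Finset β} (hf : ∀ x ∈ s, f x ∈ F) :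
    μ.real s ≤ ∑ b ∈ F, μ.real (s ∩ f ⁻¹' {b}) := by
  refine (measureReal_mono (fun x hx => ?_) (measure_ne_top μ _)).trans
    (measureReal_biUnion_finset_le F _)
  exact Set.mem_iUnion₂.2 ⟨f x, hf x hx, hx, rfl⟩

lemma measureReal_le_of_forall_inter_cyl_le [IsProbabilityMeasure μ] {s : Set (Shift m)} {j : ℕ}
    {c : ℝ} (h : ∀ x, μ.real (s ∩ cyl x j) ≤ c * μ.real (cyl x j)) : μ.real s ≤ c := by
  let res : Shift m → Fin j → Fin m := fun x i => x i
  have hres : Measurable res := by fun_prop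
  have hcyl (x : Shift m) : res ⁻¹' {res x} = cyl x j := by
    ext y
    exact ⟨fun hy i hi => congrFun hy ⟨i, hi⟩, fun hy => funext fun i => hy i i.2⟩
  have hfiber (w : Fin j → Fin m) : μ.real (s ∩ res ⁻¹' {w}) ≤ c * μ.real (res ⁻¹' {w}) := by
    rcases (res ⁻¹' {w}).eq_empty_or_nonempty with hw | ⟨x, rfl⟩
    · simp only [hw, Set.inter_empty, measureReal_empty, mul_zero, le_refl]
    · rw [hcyl]
      exact h x
  calc μ.real s ≤ ∑ w, μ.real (s ∩ res ⁻¹' {w}) :=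
        measureReal_le_sum_inter_preimage fun _ _ => Finset.mem_univ _
    _ ≤ ∑ w, c * μ.real (res ⁻¹' {w}) := Finset.sum_le_sum fun w _ => hfiber w
    _ = c := by
      rw [← Finset.mul_sum, sum_measureReal_preimage_singleton _
        fun w _ => hres (measurableSet_singleton w)]
      simp

/-- A bound, up to `zFun M r`, for the number of the cells of size `r` that are needed to cover
the image under `M` of the attractor with translations `a`. -/
def cellBound (T : Fin m → Matrix (Fin d) (Fin d) ℝ) (a : Fin m → E d) : ℝ :=
  (2 * ((1 - ratio T)⁻¹ * ‖a‖ * d) + 3) ^ d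

lemma measureReal_few_near_inter_cyl_le [IsFiniteMeasure μ] (hT : ∀ i, IsUnit (T i))
    (hT1 : ratio T < 1) (a : Fin m → E d) (x₀ : Shift m) (j : ℕ) {r c : ℝ} (hr : 0 < r)
    (hc : 0 ≤ c) :
    μ.real {x ∈ cyl x₀ j | μ.real (near T a x r) < c} * zFun (wordMat T x₀ j) r
      ≤ cellBound T a * c := by
  set s := {x ∈ cyl x₀ j | μ.real (near T a x r) < c}
  set M := wordMat T x₀ j
  have hM : IsUnit M := isUnit_wordMat hT x₀ j
  let q (x : Shift m) : Fin d → ℤ := cellIndex M r (coding T a fun i => x (j + i))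
  obtain ⟨F, hF, hcard⟩ := exists_finset_cellIndex_mem hM
    (mul_nonneg (inv_nonneg.2 (sub_nonneg.2 hT1.le)) (norm_nonneg a)) hr
  have hcell (z : Fin d → ℤ) : μ.real (s ∩ q ⁻¹' {z}) ≤ c := by
    rcases (s ∩ q ⁻¹' {z}).eq_empty_or_nonempty with hempty | ⟨x, ⟨hx, hxc⟩, rfl⟩
    · rwa [hempty, measureReal_empty]
    refine (measureReal_mono ?_).trans hxc.le
    rintro y ⟨⟨hy, -⟩, hyz⟩
    rw [near, Set.mem_ofPred_eq, coding_sub_coding hT1 a fun i hi => (hx i hi).trans (hy i hi).symm,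
      map_sub, wordMat_congr hx]
    exact norm_sub_le_of_cellIndex_eq hM hr (Eq.symm hyz)
  have hs : μ.real s ≤ F.card * c := calc
    μ.real s ≤ ∑ z ∈ F, μ.real (s ∩ q ⁻¹' {z}) :=
      measureReal_le_sum_inter_preimage fun x _ => hF _ (norm_coding_le hT1 a _)
    _ ≤ F.card • c := Finset.sum_le_card_nsmul _ _ _ fun z _ => hcell z
    _ = F.card * c := nsmul_eq_mul _ _
  calc μ.real s * zFun M r ≤ F.card * c * zFun M r := by gcongr; exact zFun_nonneg M hr.le
    _ = F.card * zFun M r * c := by ring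
    _ ≤ cellBound T a * c := by gcongr; exact hcard

variable [IsProbabilityMeasure μ]

lemma measureReal_near_lt_cyl_le (hT : ∀ i, IsUnit (T i)) (hT1 : ratio T < 1) (a : Fin m → E d)
    (j : ℕ) {r ε : ℝ} (hr : 0 < r) (hε : 0 ≤ ε) :
    μ.real {x | μ.real (near T a x r) < ε * (μ.real (cyl x j) * zFun (wordMat T x j) r)}
      ≤ cellBound T a * ε := by
  refine measureReal_le_of_forall_inter_cyl_le (j := j) fun x₀ => ?_
  have hz : 0 < zFun (wordMat T x₀ j) r := zFun_pos (isUnit_wordMat hT x₀ j) hr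
  refine le_of_mul_le_mul_right ?_ hz
  calc _ ≤ μ.real {x ∈ cyl x₀ j | μ.real (near T a x r)
          < ε * (μ.real (cyl x₀ j) * zFun (wordMat T x₀ j) r)} * zFun (wordMat T x₀ j) r := by
        refine mul_le_mul_of_nonneg_right (measureReal_mono ?_) hz.le
        rintro x ⟨hx, hxj⟩
        refine ⟨hxj, ?_⟩
        rwa [Set.mem_ofPred_eq, cyl_congr hxj, wordMat_congr hxj] at hx
    _ ≤ cellBound T a * (ε * (μ.real (cyl x₀ j) * zFun (wordMat T x₀ j) r)) :=
        measureReal_few_near_inter_cyl_le hT hT1 a x₀ j hr (by positivity)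
    _ = cellBound T a * ε * μ.real (cyl x₀ j) * zFun (wordMat T x₀ j) r := by ring

lemma measureReal_near_lt_G_le (hT : ∀ i, IsUnit (T i)) (hT1 : ratio T < 1) (a : Fin m → E d)
    {n : ℕ} {r ε : ℝ} (hr : 0 < r) (hn : ratio T ^ n ≤ r) (hε : 0 ≤ ε) :
    μ.real {x | μ.real (near T a x r) < ε * G T μ x r}
      ≤ cellBound T a * (((n : ℝ) + 1) ^ 2 * ε) := by
  set A : ℕ → Set (Shift m) := fun j => {x | μ.real (near T a x r)
    < ((n : ℝ) + 1) * ε * (μ.real (cyl x j) * zFun (wordMat T x j) r)} with hA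
  have hsub : {x | μ.real (near T a x r) < ε * G T μ x r} ⊆ ⋃ j ∈ Finset.range (n + 1), A j := by
    intro x hx
    by_contra hxA
    simp only [hA, Set.mem_iUnion, Set.mem_ofPred_eq, exists_prop, not_exists, not_and,
      not_lt] at hxA
    have hsum := Finset.sum_le_card_nsmul _ _ _ hxA
    rw [← Finset.mul_sum, Finset.card_range, nsmul_eq_mul, Nat.cast_add_one, mul_assoc] at hsum
    refine (le_of_mul_le_mul_left hsum (by positivity)).not_gt (hx.trans_le ?_)
    exact mul_le_mul_of_nonneg_left (G_le_sum hT hT1.le x hn) hε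
  calc _ ≤ ∑ j ∈ Finset.range (n + 1), μ.real (A j) :=
        (measureReal_mono hsub (measure_ne_top μ _)).trans (measureReal_biUnion_finset_le _ _)
    _ ≤ (Finset.range (n + 1)).card • (cellBound T a * (((n : ℝ) + 1) * ε)) :=
        Finset.sum_le_card_nsmul _ _ _ fun j _ =>
          measureReal_near_lt_cyl_le hT hT1 a j hr (by positivity)
    _ = cellBound T a * (((n : ℝ) + 1) ^ 2 * ε) := by
        rw [Finset.card_range, nsmul_eq_mul, Nat.cast_add_one]
        ring

lemma ae_eventually_G_le (hT : ∀ i, IsUnit (T i)) (hT2 : ratio T ≤ 1 / 2) (a : Fin m → E d) :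
    ∀ᵐ x ∂μ, ∀ᶠ n : ℕ in atTop,
      G T μ x ((1 / 2) ^ n) ≤ ((n : ℝ) + 1) ^ 4 * μ.real (near T a x ((1 / 2) ^ n)) := by
  have hrare (n : ℕ) : μ.real {x | μ.real (near T a x ((1 / 2) ^ n))
      < (((n : ℝ) + 1) ^ 4)⁻¹ * G T μ x ((1 / 2) ^ n)}
        ≤ cellBound T a * (((n : ℝ) + 1) ^ 2)⁻¹ := by
    refine (measureReal_near_lt_G_le hT (hT2.trans_lt (by norm_num)) a (by positivity)
      (pow_le_pow_left₀ (ratio_nonneg T) hT2 n) (by positivity)).trans_eq ?_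
    field_simp
  filter_upwards [ae_eventually_notMem_of_summable <| .of_nonneg_of_le
    (fun n => measureReal_nonneg) hrare (summable_inv_natCast_add_one_sq.mul_left _)] with x hx
  filter_upwards [hx] with n hn
  exact (inv_mul_le_iff₀ (by positivity)).1 (not_lt.1 hn)

lemma ae_ae_eventually_measure_near_comparable (hT : ∀ i, IsUnit (T i)) (hT2 : ratio T < 1 / 2) :
    ∀ᵐ a : Fin m → E d, ∀ᵐ x ∂μ, ∀ᶠ n : ℕ in atTop,
      μ.real (near T a x ((1 / 2) ^ n)) ≤ ((n : ℝ) + 1) ^ 4 * G T μ x ((1 / 2) ^ n) ∧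
      G T μ x ((1 / 2) ^ n) ≤ ((n : ℝ) + 1) ^ 4 * μ.real (near T a x ((1 / 2) ^ n)) := by
  filter_upwards [ae_ae_eventually_measure_near_le (μ := μ) hT hT2] with a ha
  filter_upwards [ha, ae_eventually_G_le hT hT2.le a] with x hx hx'
  filter_upwards [hx, hx'] with n hn hn'
  refine ⟨hn.trans ?_, hn'⟩
  gcongr
  · exact (G_pos hT (hT2.le.trans (by norm_num)) x (by positivity)).le
  · exact le_add_of_nonneg_left n.cast_nonneg
  · norm_num

end Estimates

section Asymptotics

lemma eventually_pos_and_lt_one : ∀ᶠ r in 𝓝[>] (0 : ℝ), 0 < r ∧ r < 1 :=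
  Ioo_mem_nhdsGT one_pos

lemma eventually_nhdsGT_zero_of_dyadic {P : ℝ → Prop}
    (h : ∀ᶠ n : ℕ in atTop, ∀ r : ℝ, (1 / 2) ^ (n + 1) < r → r ≤ (1 / 2) ^ n → P r) :
    ∀ᶠ r in 𝓝[>] (0 : ℝ), P r := by
  obtain ⟨N, hN⟩ := eventually_atTop.1 h
  filter_upwards [Ioo_mem_nhdsGT (show (0 : ℝ) < (1 / 2) ^ N by positivity)] with r ⟨hr0, hrN⟩
  have hr1 : r ≤ 1 := hrN.le.trans (pow_le_one₀ (by norm_num) (by norm_num))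
  obtain ⟨n, hn, hn'⟩ := exists_nat_pow_near_of_lt_one hr0 hr1
    (by norm_num : (0 : ℝ) < 1 / 2) (by norm_num)
  refine hN n ?_ r hn hn'
  exact Nat.lt_add_one_iff.1 <|
    (pow_lt_pow_iff_right_of_lt_one₀ (by norm_num) (by norm_num)).1 (hn.trans hrN)

lemma eventually_mul_pow_le_pow (K : ℝ) (k : ℕ) {b : ℝ} (hb : 1 < b) :
    ∀ᶠ n : ℕ in atTop, K * ((n : ℝ) + 2) ^ k ≤ b ^ n := by
  have h : Tendsto (fun n : ℕ => K * b ^ 2 * (((n + 2 : ℕ) : ℝ) ^ k / b ^ (n + 2))) atTop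
      (𝓝 0) := by
    simpa only [mul_zero] using ((tendsto_add_atTop_iff_nat 2).2
      (tendsto_pow_const_div_const_pow_of_one_lt k hb)).const_mul (K * b ^ 2)
  filter_upwards [h.eventually_le_const one_pos] with n hn
  have hb0 : 0 < b := one_pos.trans hb
  rw [← div_le_one (pow_pos hb0 n)]
  refine Eq.trans_le ?_ hn
  push_cast
  field_simp
  ring

lemma eventually_mul_pow_le_rpow_neg (K : ℝ) (k : ℕ) {ε : ℝ} (hε : 0 < ε) :
    ∀ᶠ n : ℕ in atTop, ∀ r : ℝ, 0 < r → r ≤ (1 / 2) ^ n → K * ((n : ℝ) + 2) ^ k ≤ r ^ (-ε) := by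
  filter_upwards [eventually_mul_pow_le_pow K k (Real.one_lt_rpow one_lt_two hε)] with n hn r hr hrn
  calc K * ((n : ℝ) + 2) ^ k ≤ ((2 : ℝ) ^ ε) ^ n := hn
    _ = ((1 / 2 : ℝ) ^ n) ^ (-ε) := by
      rw [one_div, inv_pow, Real.inv_rpow (by positivity), Real.rpow_neg (by positivity), inv_inv,
        Real.rpow_pow_comm zero_le_two]
    _ ≤ r ^ (-ε) := Real.rpow_le_rpow_of_nonpos hr hrn (neg_nonpos.2 hε.le)

lemma eventually_le_rpow_mul_of_dyadic {f g : ℝ → ℝ} {K : ℝ} {k : ℕ}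
    (hf : MonotoneOn f (Set.Ioi 0)) (hg : MonotoneOn g (Set.Ioi 0)) (hg0 : ∀ r > 0, 0 ≤ g r)
    (h : ∀ᶠ n : ℕ in atTop,
      f ((1 / 2) ^ n) ≤ K * ((n : ℝ) + 2) ^ k * g ((1 / 2) ^ (n + 1)))
    {ε : ℝ} (hε : 0 < ε) : ∀ᶠ r in 𝓝[>] (0 : ℝ), f r ≤ r ^ (-ε) * g r := by
  have hpow (n : ℕ) : (1 / 2 : ℝ) ^ n ∈ Set.Ioi 0 := Set.mem_Ioi.2 (by positivity)
  refine eventually_nhdsGT_zero_of_dyadic ?_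
  filter_upwards [h, eventually_mul_pow_le_rpow_neg |K| k hε] with n hn hK r hr hr'
  have hr0 : 0 < r := lt_trans (hpow _) hr
  calc f r ≤ f ((1 / 2) ^ n) := hf hr0 (hpow n) hr'
    _ ≤ K * ((n : ℝ) + 2) ^ k * g ((1 / 2) ^ (n + 1)) := hn
    _ ≤ |K| * ((n : ℝ) + 2) ^ k * g r := by
        gcongr
        · exact hg0 _ (hpow _)
        · exact le_abs_self K
        · exact hg (hpow _) hr0 hr.le
    _ ≤ r ^ (-ε) * g r := mul_le_mul_of_nonneg_right (hK r hr0 hr') (hg0 r hr0)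

lemma log_div_log_le_add_of_le_rpow_mul {u v r ε : ℝ} (hu : 0 < u) (hr : 0 < r) (hr1 : r < 1)
    (h : u ≤ r ^ (-ε) * v) : Real.log v / Real.log r ≤ Real.log u / Real.log r + ε := by
  have hlog : Real.log r < 0 := Real.log_neg hr hr1
  have hv : 0 < v := pos_of_mul_pos_right (hu.trans_le h) (Real.rpow_nonneg hr.le _)
  have huv : Real.log u ≤ -ε * Real.log r + Real.log v := by
    rw [← Real.log_rpow hr, ← Real.log_mul (Real.rpow_pos_of_pos hr _).ne' hv.ne']
    exact Real.log_le_log hu h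
  rw [div_add' _ _ _ hlog.ne]
  exact div_le_div_of_nonpos_of_le hlog.le (by linarith)

lemma limsup_coe_le_of_eventually_le_add {α : Type*} {l : Filter α} {f g : α → ℝ}
    (h : ∀ ε > 0, ∀ᶠ x in l, f x ≤ g x + ε) :
    limsup (fun x => (f x : EReal)) l ≤ limsup (fun x => (g x : EReal)) l := by
  refine le_of_forall_gt_imp_ge_of_dense fun c hc => ?_
  obtain ⟨q, hq, hqc⟩ := EReal.lt_iff_exists_real_btwn.1 hc
  obtain ⟨q', hq', hqc'⟩ := EReal.lt_iff_exists_real_btwn.1 hqc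
  have hqq : q < q' := EReal.coe_lt_coe_iff.1 hq'
  refine (limsup_le_of_le (by isBoundedDefault) ?_).trans hqc'.le
  filter_upwards [eventually_lt_of_limsup_lt hq, h (q' - q) (by linarith)] with x hx hx'
  have hx : g x < q := EReal.coe_lt_coe_iff.1 hx
  exact EReal.coe_le_coe_iff.2 (by linarith)

lemma liminf_coe_le_of_eventually_le_add {α : Type*} {l : Filter α} {f g : α → ℝ}
    (h : ∀ ε > 0, ∀ᶠ x in l, f x ≤ g x + ε) :
    liminf (fun x => (f x : EReal)) l ≤ liminf (fun x => (g x : EReal)) l := by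
  have hneg : limsup (fun x => ((-g x : ℝ) : EReal)) l ≤ limsup (fun x => ((-f x : ℝ) : EReal)) l :=
    limsup_coe_le_of_eventually_le_add fun ε hε => (h ε hε).mono fun x hx => by linarith
  simp only [EReal.coe_neg] at hneg
  rwa [← Pi.neg_def, ← Pi.neg_def, EReal.limsup_neg, EReal.limsup_neg, EReal.neg_le_neg_iff] at hneg

variable {f g : ℝ → ℝ}

lemma eventually_log_div_log_le_add (hf : ∀ᶠ r in 𝓝[>] 0, 0 < f r)
    (h : ∀ ε > (0 : ℝ), ∀ᶠ r in 𝓝[>] 0, f r ≤ r ^ (-ε) * g r) {ε : ℝ} (hε : 0 < ε) :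
    ∀ᶠ r in 𝓝[>] 0, Real.log (g r) / Real.log r ≤ Real.log (f r) / Real.log r + ε := by
  filter_upwards [h ε hε, hf, eventually_pos_and_lt_one] with r hr hfr ⟨hr0, hr1⟩
  exact log_div_log_le_add_of_le_rpow_mul hfr hr0 hr1 hr

lemma limsup_log_div_log_le (hf : ∀ᶠ r in 𝓝[>] 0, 0 < f r)
    (h : ∀ ε > (0 : ℝ), ∀ᶠ r in 𝓝[>] 0, f r ≤ r ^ (-ε) * g r) :
    limsup (fun r => ((Real.log (g r) / Real.log r : ℝ) : EReal)) (𝓝[>] 0)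
      ≤ limsup (fun r => ((Real.log (f r) / Real.log r : ℝ) : EReal)) (𝓝[>] 0) :=
  limsup_coe_le_of_eventually_le_add fun _ hε => eventually_log_div_log_le_add hf h hε

lemma liminf_log_div_log_le (hf : ∀ᶠ r in 𝓝[>] 0, 0 < f r)
    (h : ∀ ε > (0 : ℝ), ∀ᶠ r in 𝓝[>] 0, f r ≤ r ^ (-ε) * g r) :
    liminf (fun r => ((Real.log (g r) / Real.log r : ℝ) : EReal)) (𝓝[>] 0)
      ≤ liminf (fun r => ((Real.log (f r) / Real.log r : ℝ) : EReal)) (𝓝[>] 0) :=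
  liminf_coe_le_of_eventually_le_add fun _ hε => eventually_log_div_log_le_add hf h hε

lemma eq_coe_min_of_forall_lt {D : ℝ} {l : EReal} {L : ℝ≥0∞} (hl0 : 0 ≤ l) (hlD : l ≤ D)
    (hle : ∀ t : ℝ, 0 ≤ t → t < D → L < ENNReal.ofReal t → l ≤ t)
    (hge : ∀ t : ℝ, 0 ≤ t → t < D → ENNReal.ofReal t < L → t ≤ l) :
    l = ((min (ENNReal.ofReal D) L : ℝ≥0∞) : EReal) := by
  have hofReal {t : ℝ} (ht : 0 ≤ t) : ((ENNReal.ofReal t : ℝ≥0∞) : EReal) = t := by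
    rw [EReal.coe_ennreal_ofReal, max_eq_left ht]
  refine le_antisymm (le_of_forall_gt_imp_ge_of_dense fun c hc => ?_)
    (le_of_forall_lt_imp_le_of_dense fun c hc => ?_)
  · rcases le_or_gt (D : EReal) c with hDc | hcD
    · exact hlD.trans hDc
    obtain ⟨t, ht, htc⟩ := EReal.lt_iff_exists_real_btwn.1 hc
    have ht0 : 0 ≤ t := EReal.coe_nonneg.1 ((EReal.coe_ennreal_nonneg _).trans ht.le)
    have htD : t < D := EReal.coe_lt_coe_iff.1 (htc.trans hcD)
    rw [← hofReal ht0, EReal.coe_ennreal_lt_coe_ennreal_iff] at ht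
    have hLt : L < ENNReal.ofReal t :=
      (min_lt_iff.1 ht).resolve_left (ENNReal.ofReal_le_ofReal htD.le).not_gt
    exact (hle t ht0 htD hLt).trans htc.le
  · obtain ⟨t, hct, ht⟩ := EReal.lt_iff_exists_real_btwn.1 hc
    refine hct.le.trans ?_
    rcases le_total t 0 with ht0 | ht0
    · exact (EReal.coe_nonpos.2 ht0).trans hl0
    rw [← hofReal ht0, EReal.coe_ennreal_lt_coe_ennreal_iff, lt_min_iff] at ht
    exact hge t ht0 ((ENNReal.ofReal_lt_ofReal_iff_of_nonneg ht0).1 ht.1) ht.2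

end Asymptotics

section AlmostEverywhere

lemma ae_map_of_ae_of_continuous {X Y : Type*} [TopologicalSpace X] [T2Space X]
    [MeasurableSpace X] [OpensMeasurableSpace X] [TopologicalSpace Y] [T2Space Y]
    [MeasurableSpace Y] [BorelSpace Y] {μ : Measure X} [IsFiniteMeasure μ]
    [μ.InnerRegularCompactLTTop] {f : X → Y} (hf : Continuous f)
    {P : Y → Prop} (h : ∀ᵐ x ∂μ, P (f x)) : ∀ᵐ y ∂(μ.map f), P y := by
  rw [ae_iff] at h ⊢
  set t := toMeasurable μ {x | ¬P (f x)}
  have ht : μ t = 0 := by rw [measure_toMeasurable, h]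
  have htm : MeasurableSet t := measurableSet_toMeasurable _ _
  refine nonpos_iff_eq_zero.1 (le_of_forall_pos_le_add fun ε hε => ?_)
  -- `P` need not be measurable, but it holds on the compact image of `K`, which almost has full
  -- measure.
  obtain ⟨K, hKt, hK, hKε⟩ := htm.compl.exists_isCompact_sdiff_lt (measure_ne_top μ _) hε.ne'
  have hsub : {y | ¬P y} ⊆ (f '' K)ᶜ := by
    rintro y hy ⟨x, hx, rfl⟩
    exact hKt hx (subset_toMeasurable μ _ hy)
  have hpre : f ⁻¹' (f '' K)ᶜ ⊆ t ∪ (tᶜ \ K) := fun x hx => by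
    by_cases hxt : x ∈ t
    · exact .inl hxt
    · exact .inr ⟨hxt, fun hxK => hx ⟨x, hxK, rfl⟩⟩
  calc μ.map f {y | ¬P y} ≤ μ.map f (f '' K)ᶜ := measure_mono hsub
    _ = μ (f ⁻¹' (f '' K)ᶜ) :=
        Measure.map_apply hf.measurable (hK.image hf).measurableSet.compl
    _ ≤ μ t + μ (tᶜ \ K) := (measure_mono hpre).trans (measure_union_le _ _)
    _ ≤ 0 + ε := by rw [ht]; gcongr

end AlmostEverywhere

section LocalDimensions

variable {d m : ℕ}

lemma logRatio_eventuallyEq {η : Measure (E d)} {x : E d}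
    (h : ∀ᶠ r in 𝓝[>] (0 : ℝ), 0 < η.real (Metric.closedBall x r)) :
    logRatio η x =ᶠ[𝓝[>] 0]
      fun r => ((Real.log (η.real (Metric.closedBall x r)) / Real.log r : ℝ) : EReal) := by
  filter_upwards [h] with r hr
  rw [logRatio, ENNReal.log_pos_real' hr, ← EReal.coe_div, measureReal_def]

lemma locDim_eq_of_comparable {η : Measure (E d)} {x : E d} {g : ℝ → ℝ}
    (hg : ∀ᶠ r in 𝓝[>] (0 : ℝ), 0 < g r)
    (hη_le : ∀ ε > (0 : ℝ), ∀ᶠ r in 𝓝[>] 0, η.real (Metric.closedBall x r) ≤ r ^ (-ε) * g r)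
    (hle_η : ∀ ε > (0 : ℝ), ∀ᶠ r in 𝓝[>] 0, g r ≤ r ^ (-ε) * η.real (Metric.closedBall x r)) :
    lowerLocDim η x = liminf (fun r => ((Real.log (g r) / Real.log r : ℝ) : EReal)) (𝓝[>] 0) ∧
      upperLocDim η x =
        limsup (fun r => ((Real.log (g r) / Real.log r : ℝ) : EReal)) (𝓝[>] 0) := by
  have hη : ∀ᶠ r in 𝓝[>] (0 : ℝ), 0 < η.real (Metric.closedBall x r) := by
    filter_upwards [hle_η 1 one_pos, hg, eventually_pos_and_lt_one] with r hr hgr ⟨hr0, _⟩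
    exact pos_of_mul_pos_right (hgr.trans_le hr) (Real.rpow_nonneg hr0.le _)
  rw [lowerLocDim, upperLocDim, liminf_congr (logRatio_eventuallyEq hη),
    limsup_congr (logRatio_eventuallyEq hη)]
  exact ⟨(liminf_log_div_log_le hg hle_η).antisymm (liminf_log_div_log_le hη hη_le),
    (limsup_log_div_log_le hg hle_η).antisymm (limsup_log_div_log_le hη hη_le)⟩

variable {T : Fin m → Matrix (Fin d) (Fin d) ℝ} {μ : Measure (Shift m)} {x : Shift m}

/-- The lower counterpart `liminf_{r → 0} log G_μ(x, r) / log r` of `D(μ, x)`. -/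
def lowerD (T : Fin m → Matrix (Fin d) (Fin d) ℝ) (μ : Measure (Shift m)) (x : Shift m) : EReal :=
  liminf (fun r : ℝ => ((Real.log (G T μ x r) / Real.log r : ℝ) : EReal)) (𝓝[>] 0)

lemma lowerD_le_D (T : Fin m → Matrix (Fin d) (Fin d) ℝ) (μ : Measure (Shift m)) (x : Shift m) :
    lowerD T μ x ≤ D T μ x :=
  liminf_le_limsup

lemma map_coding_closedBall (hT1 : ratio T < 1) (a : Fin m → E d) (x : Shift m) (r : ℝ) :
    μ.map (coding T a) (Metric.closedBall (coding T a x) r) = μ (near T a x r) := by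
  rw [Measure.map_apply (continuous_coding hT1 a).measurable measurableSet_closedBall]
  congr 1
  ext y
  rw [Set.mem_preimage, Metric.mem_closedBall, dist_comm, dist_eq_norm]
  rfl

lemma monotone_measureReal_near [IsFiniteMeasure μ] (a : Fin m → E d) (x : Shift m) :
    Monotone fun r => μ.real (near T a x r) :=
  fun _ _ h => measureReal_mono (near_mono T a x h)

lemma monotoneOn_G [IsFiniteMeasure μ] (x : Shift m) : MonotoneOn (G T μ x) (Set.Ioi 0) :=
  fun _ hr _ _ h => G_mono x (Set.mem_Ioi.1 hr).le h

lemma G_half_pow_le [IsFiniteMeasure μ] (x : Shift m) (n : ℕ) :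
    G T μ x ((1 / 2) ^ n) ≤ 2 ^ d * G T μ x ((1 / 2) ^ (n + 1)) := by
  convert G_mul_le (T := T) (μ := μ) x one_le_two
    (by positivity : (0 : ℝ) ≤ (1 / 2) ^ (n + 1)) using 2
  ring

lemma eventually_measure_near_le_rpow_mul_G [IsFiniteMeasure μ] {a : Fin m → E d} {k : ℕ}
    (hG0 : ∀ r > 0, 0 ≤ G T μ x r)
    (h : ∀ᶠ n : ℕ in atTop,
      μ.real (near T a x ((1 / 2) ^ n)) ≤ ((n : ℝ) + 1) ^ k * G T μ x ((1 / 2) ^ n))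
    {ε : ℝ} (hε : 0 < ε) :
    ∀ᶠ r in 𝓝[>] (0 : ℝ), μ.real (near T a x r) ≤ r ^ (-ε) * G T μ x r := by
  refine eventually_le_rpow_mul_of_dyadic (K := 2 ^ d) (k := k)
    ((monotone_measureReal_near a x).monotoneOn _) (monotoneOn_G x) hG0 ?_ hε
  filter_upwards [h] with n hn
  calc μ.real (near T a x ((1 / 2) ^ n)) ≤ ((n : ℝ) + 1) ^ k * G T μ x ((1 / 2) ^ n) := hn
    _ ≤ ((n : ℝ) + 2) ^ k * (2 ^ d * G T μ x ((1 / 2) ^ (n + 1))) := by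
      gcongr
      · exact hG0 _ (by positivity)
      · norm_num
      · exact G_half_pow_le x n
    _ = 2 ^ d * ((n : ℝ) + 2) ^ k * G T μ x ((1 / 2) ^ (n + 1)) := by ring

lemma eventually_G_le_rpow_mul_measure_near [IsFiniteMeasure μ] {a : Fin m → E d} {k : ℕ}
    (h : ∀ᶠ n : ℕ in atTop,
      G T μ x ((1 / 2) ^ n) ≤ ((n : ℝ) + 1) ^ k * μ.real (near T a x ((1 / 2) ^ n)))
    {ε : ℝ} (hε : 0 < ε) :
    ∀ᶠ r in 𝓝[>] (0 : ℝ), G T μ x r ≤ r ^ (-ε) * μ.real (near T a x r) := by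
  refine eventually_le_rpow_mul_of_dyadic (K := 2 ^ d) (k := k) (monotoneOn_G x)
    ((monotone_measureReal_near a x).monotoneOn _) (fun _ _ => measureReal_nonneg) ?_ hε
  filter_upwards [(tendsto_add_atTop_nat 1).eventually h] with n hn
  calc G T μ x ((1 / 2) ^ n) ≤ 2 ^ d * G T μ x ((1 / 2) ^ (n + 1)) := G_half_pow_le x n
    _ ≤ 2 ^ d * ((((n + 1 : ℕ) : ℝ) + 1) ^ k * μ.real (near T a x ((1 / 2) ^ (n + 1)))) := by
      gcongr
    _ = 2 ^ d * ((n : ℝ) + 2) ^ k * μ.real (near T a x ((1 / 2) ^ (n + 1))) := by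
      push_cast
      ring

lemma svFun_le_of_S_lt (hT : ∀ i, IsUnit (T i)) (hT1 : ratio T ≤ 1) {t : ℝ} (ht : 0 ≤ t)
    (htd : t < d) {n : ℕ} (h : S T μ n x < ENNReal.ofReal t) :
    svFun t (wordMat T x n) ≤ μ.real (cyl x n) := by
  obtain ⟨s, hs, hst⟩ := sInf_lt_iff.1 h
  have hs : svFunExt s (wordMat T x n) = μ.real (cyl x n) := hs
  rw [svFunExt, if_neg hst.ne_top] at hs
  rw [← hs]
  exact svFun_anti (isUnit_wordMat hT x n) (opNorm_wordMat_le_one hT1 x n)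
    ENNReal.toReal_nonneg (ENNReal.toReal_le_of_le_ofReal ht hst.le) htd

variable [IsProbabilityMeasure μ]

lemma le_svFun_of_lt_S (hT : ∀ i, IsUnit (T i)) {t : ℝ} (ht : 0 ≤ t) (htd : t < d) {n : ℕ}
    (h : ENNReal.ofReal t < S T μ n x) : μ.real (cyl x n) ≤ svFun t (wordMat T x n) := by
  by_contra! hlt
  obtain ⟨s, ⟨hs0, hst⟩, hs⟩ := exists_svFun_eq (isUnit_wordMat hT x n) ht htd hlt.le
    measureReal_le_one
  have hmem : svFunExt (ENNReal.ofReal s) (wordMat T x n) = μ.real (cyl x n) := by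
    rw [svFunExt, if_neg ENNReal.ofReal_ne_top, ENNReal.toReal_ofReal hs0, hs]
  have hS : S T μ n x ≤ ENNReal.ofReal s := sInf_le hmem
  exact h.not_ge (hS.trans (ENNReal.ofReal_le_ofReal hst))

lemma ae_ae_locDim_eq (hT : ∀ i, IsUnit (T i)) (hT2 : ratio T < 1 / 2) :
    ∀ᵐ a : Fin m → E d, ∀ᵐ x ∂μ,
      lowerLocDim (μ.map (coding T a)) (coding T a x) = lowerD T μ x ∧
        upperLocDim (μ.map (coding T a)) (coding T a x) = D T μ x := by
  have hT1 : ratio T < 1 := hT2.trans (by norm_num)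
  filter_upwards [ae_ae_eventually_measure_near_comparable (μ := μ) hT hT2] with a ha
  filter_upwards [ha] with x hx
  have hG (r : ℝ) (hr : r > 0) : 0 < G T μ x r := G_pos hT hT1.le x hr
  refine locDim_eq_of_comparable (eventually_nhdsWithin_of_forall hG) (fun ε hε => ?_)
    fun ε hε => ?_ <;> simp only [measureReal_def, map_coding_closedBall hT1]
  · exact eventually_measure_near_le_rpow_mul_G (fun r hr => (hG r hr).le)
      (hx.mono fun n hn => hn.1) hε
  · exact eventually_G_le_rpow_mul_measure_near (hx.mono fun n hn => hn.2) hε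

lemma eventually_log_G_div_log_mem_Icc (hT : ∀ i, IsUnit (T i)) (hT1 : ratio T ≤ 1)
    (x : Shift m) :
    ∀ᶠ r in 𝓝[>] (0 : ℝ), Real.log (G T μ x r) / Real.log r ∈ Set.Icc 0 (d : ℝ) := by
  filter_upwards [eventually_pos_and_lt_one] with r ⟨hr0, hr1⟩
  have hlog : Real.log r < 0 := Real.log_neg hr0 hr1
  have hG : 0 < G T μ x r := G_pos hT hT1 x hr0
  refine ⟨div_nonneg_of_nonpos (Real.log_nonpos hG.le (G_le_one x hr0.le)) hlog.le, ?_⟩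
  rw [div_le_iff_of_neg hlog, ← Real.log_pow]
  exact Real.log_le_log (pow_pos hr0 d) (pow_le_G hT hT1 x hr0.le hr1.le)

lemma D_le (hT : ∀ i, IsUnit (T i)) (hT1 : ratio T ≤ 1) (x : Shift m) :
    D T μ x ≤ ((d : ℝ) : EReal) :=
  limsup_le_of_le (by isBoundedDefault) <|
    (eventually_log_G_div_log_mem_Icc hT hT1 x).mono fun _ hr => EReal.coe_le_coe_iff.2 hr.2

lemma lowerD_nonneg (hT : ∀ i, IsUnit (T i)) (hT1 : ratio T ≤ 1) (x : Shift m) :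
    0 ≤ lowerD T μ x :=
  le_liminf_of_le (by isBoundedDefault) <|
    (eventually_log_G_div_log_mem_Icc hT hT1 x).mono fun _ hr => EReal.coe_nonneg.2 hr.1

lemma lowerD_le_of_liminf_S_lt (hT : ∀ i, IsUnit (T i)) (hT1 : ratio T < 1) {t : ℝ}
    (ht : 0 ≤ t) (htd : t < d) (h : liminf (fun n => S T μ n x) atTop < ENNReal.ofReal t) :
    lowerD T μ x ≤ t := by
  -- At the scale `α_⌊t⌋` of `T_{x|n}` the bound `Z(r) φ^t ≤ r^t` is an equality.
  let r (n : ℕ) : ℝ := sv (wordMat T x n) ⌊t⌋₊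
  have hr0 (n : ℕ) : 0 < r n := sv_pos (isUnit_wordMat hT x n) ((Nat.floor_lt ht).2 htd)
  have hr : Tendsto r atTop (𝓝[>] 0) := by
    refine tendsto_nhdsWithin_iff.2 ⟨?_, Eventually.of_forall hr0⟩
    exact squeeze_zero (fun n => (hr0 n).le)
      (fun n => (sv_le_opNorm _ _).trans (opNorm_wordMat_le T x n))
      (tendsto_pow_atTop_nhds_zero_of_lt_one (ratio_nonneg T) hT1)
  have hlt : ∃ᶠ n in atTop, S T μ n x < ENNReal.ofReal t :=
    frequently_lt_of_liminf_lt (by isBoundedDefault) h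
  refine liminf_le_of_frequently_le (hr.frequently ?_) (by isBoundedDefault)
  refine (hlt.and_eventually (hr.eventually eventually_pos_and_lt_one)).mono ?_
  rintro n ⟨hn, -, hr1⟩
  have hG : r n ^ t ≤ G T μ x (r n) :=
    calc r n ^ t = svFun t (wordMat T x n) * zFun (wordMat T x n) (r n) := by
          rw [← zFun_mul_svFun_eq (isUnit_wordMat hT x n) ht htd, mul_comm]
      _ ≤ μ.real (cyl x n) * zFun (wordMat T x n) (r n) :=
          mul_le_mul_of_nonneg_right (svFun_le_of_S_lt hT hT1.le ht htd hn)
            (zFun_nonneg _ (hr0 n).le)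
      _ ≤ G T μ x (r n) := measureReal_cyl_mul_zFun_le_G hT hT1.le x n (hr0 n).le
  rw [EReal.coe_le_coe_iff, div_le_iff_of_neg (Real.log_neg (hr0 n) hr1),
    ← Real.log_rpow (hr0 n)]
  exact Real.log_le_log (Real.rpow_pos_of_pos (hr0 n) _) hG

lemma exists_measureReal_cyl_le_mul_svFun (hT : ∀ i, IsUnit (T i)) {t : ℝ} (ht : 0 ≤ t)
    (htd : t < d) (h : ENNReal.ofReal t < liminf (fun n => S T μ n x) atTop) :
    ∃ C > 0, ∀ n, μ.real (cyl x n) ≤ C * svFun t (wordMat T x n) := by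
  have hpos (n : ℕ) : 0 < svFun t (wordMat T x n) := svFun_pos (isUnit_wordMat hT x n) ht htd
  have hO : (fun n => μ.real (cyl x n)) =O[atTop] fun n => svFun t (wordMat T x n) := by
    refine .of_bound' ?_
    filter_upwards [eventually_lt_of_lt_liminf h] with n hn
    rw [Real.norm_of_nonneg measureReal_nonneg, Real.norm_of_nonneg (hpos n).le]
    exact le_svFun_of_lt_S hT ht htd hn
  obtain ⟨C, hC, hle⟩ := Asymptotics.bound_of_isBigO_nat_atTop hO
  refine ⟨C, hC, fun n => ?_⟩
  simpa only [Real.norm_of_nonneg measureReal_nonneg, Real.norm_of_nonneg (hpos n).le]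
    using hle (hpos n).ne'

lemma G_half_pow_le_of_measureReal_cyl_le (hT : ∀ i, IsUnit (T i)) (hT2 : ratio T ≤ 1 / 2)
    {t C : ℝ} (ht : 0 ≤ t) (htd : t < d) (hC : 0 ≤ C)
    (h : ∀ n, μ.real (cyl x n) ≤ C * svFun t (wordMat T x n)) (n : ℕ) :
    G T μ x ((1 / 2) ^ n) ≤ (n + 1) * (C * ((1 / 2 : ℝ) ^ n) ^ t) := by
  have hr : (0 : ℝ) < (1 / 2) ^ n := by positivity
  have hterm (j : ℕ) :
      μ.real (cyl x j) * zFun (wordMat T x j) ((1 / 2) ^ n) ≤ C * ((1 / 2 : ℝ) ^ n) ^ t :=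
    calc μ.real (cyl x j) * zFun (wordMat T x j) ((1 / 2) ^ n)
        ≤ C * svFun t (wordMat T x j) * zFun (wordMat T x j) ((1 / 2) ^ n) :=
          mul_le_mul_of_nonneg_right (h _) (zFun_nonneg _ hr.le)
      _ = C * (zFun (wordMat T x j) ((1 / 2) ^ n) * svFun t (wordMat T x j)) := by ring
      _ ≤ C * ((1 / 2 : ℝ) ^ n) ^ t :=
          mul_le_mul_of_nonneg_left (zFun_mul_svFun_le (isUnit_wordMat hT x j) ht htd hr) hC
  calc G T μ x ((1 / 2) ^ n)
      ≤ ∑ j ∈ Finset.range (n + 1), μ.real (cyl x j) * zFun (wordMat T x j) ((1 / 2) ^ n) :=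
        G_le_sum hT (hT2.trans (by norm_num)) x (pow_le_pow_left₀ (ratio_nonneg T) hT2 n)
    _ ≤ ∑ _j ∈ Finset.range (n + 1), C * ((1 / 2 : ℝ) ^ n) ^ t :=
        Finset.sum_le_sum fun _ _ => hterm _
    _ = (n + 1) * (C * ((1 / 2 : ℝ) ^ n) ^ t) := by simp

lemma le_lowerD_of_lt_liminf_S (hT : ∀ i, IsUnit (T i)) (hT2 : ratio T ≤ 1 / 2) {t : ℝ}
    (ht : 0 ≤ t) (htd : t < d) (h : ENNReal.ofReal t < liminf (fun n => S T μ n x) atTop) :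
    t ≤ lowerD T μ x := by
  obtain ⟨C, hC, hcyl⟩ := exists_measureReal_cyl_le_mul_svFun hT ht htd h
  have hG (n : ℕ) : G T μ x ((1 / 2) ^ n)
      ≤ C * 2 ^ t * ((n : ℝ) + 2) ^ 1 * ((1 / 2 : ℝ) ^ (n + 1)) ^ t :=
    calc G T μ x ((1 / 2) ^ n) ≤ (n + 1) * (C * ((1 / 2 : ℝ) ^ n) ^ t) :=
          G_half_pow_le_of_measureReal_cyl_le hT hT2 ht htd hC.le hcyl n
      _ ≤ (n + 2) * (C * (2 * (1 / 2 : ℝ) ^ (n + 1)) ^ t) := by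
          gcongr
          · norm_num
          · exact (by ring : (1 / 2 : ℝ) ^ n = 2 * (1 / 2) ^ (n + 1)).le
      _ = C * 2 ^ t * ((n : ℝ) + 2) ^ 1 * ((1 / 2 : ℝ) ^ (n + 1)) ^ t := by
          rw [Real.mul_rpow zero_le_two (by positivity)]
          ring
  have hle (ε : ℝ) (hε : ε > 0) : ∀ᶠ r in 𝓝[>] 0, G T μ x r ≤ r ^ (-ε) * r ^ t :=
    eventually_le_rpow_mul_of_dyadic (monotoneOn_G x)
      (fun r hr _ _ hrr => Real.rpow_le_rpow (Set.mem_Ioi.1 hr).le hrr ht)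
      (fun r hr => Real.rpow_nonneg hr.le t) (Eventually.of_forall hG) hε
  have hlog : ∀ᶠ r in 𝓝[>] (0 : ℝ), (t : EReal) = (Real.log (r ^ t) / Real.log r : ℝ) := by
    filter_upwards [eventually_pos_and_lt_one] with r ⟨hr0, hr1⟩
    rw [Real.log_rpow hr0, mul_div_cancel_right₀ _ (Real.log_neg hr0 hr1).ne]
  calc (t : EReal) = liminf (fun _ => (t : EReal)) (𝓝[>] (0 : ℝ)) := liminf_const _ |>.symm
    _ = liminf (fun r => ((Real.log (r ^ t) / Real.log r : ℝ) : EReal)) (𝓝[>] 0) :=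
        liminf_congr hlog
    _ ≤ lowerD T μ x := liminf_log_div_log_le
        (eventually_nhdsWithin_of_forall fun r hr => G_pos hT (hT2.trans (by norm_num)) x hr) hle

lemma lowerD_eq (hT : ∀ i, IsUnit (T i)) (hT2 : ratio T ≤ 1 / 2) (x : Shift m) :
    lowerD T μ x = ((min (d : ℝ≥0∞) (liminf (fun n => S T μ n x) atTop) : ℝ≥0∞) : EReal) := by
  have hT1 : ratio T < 1 := hT2.trans_lt (by norm_num)
  rw [← ENNReal.ofReal_natCast]
  exact eq_coe_min_of_forall_lt (lowerD_nonneg hT hT1.le x)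
    ((lowerD_le_D T μ x).trans (D_le hT hT1.le x))
    (fun t ht htd => lowerD_le_of_liminf_S_lt hT hT1 ht htd)
    fun t ht htd => le_lowerD_of_lt_liminf_S hT hT2 ht htd

end LocalDimensions

section ExactDimensionality

variable {d m : ℕ} {T : Fin m → Matrix (Fin d) (Fin d) ℝ} {μ : Measure (Shift m)}
  [IsProbabilityMeasure μ]

lemma lowerD_eq_coe_iff_of_lt (hT : ∀ i, IsUnit (T i)) (hT2 : ratio T ≤ 1 / 2) {s : ℝ}
    (hs : 0 ≤ s) (hsd : s < d) (x : Shift m) :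
    lowerD T μ x = s ↔ liminf (fun n => S T μ n x) atTop = ENNReal.ofReal s := by
  have hsd : ENNReal.ofReal s < d := by
    rwa [← ENNReal.ofReal_natCast, ENNReal.ofReal_lt_ofReal_iff_of_nonneg hs]
  have hs : (s : EReal) = (ENNReal.ofReal s : ℝ≥0∞) := by
    rw [EReal.coe_ennreal_ofReal, max_eq_left hs]
  rw [lowerD_eq hT hT2, hs, EReal.coe_ennreal_eq_coe_ennreal_iff, min_eq_iff]
  grind

lemma lowerD_eq_natCast_and_D_eq_natCast_iff (hT : ∀ i, IsUnit (T i)) (hT2 : ratio T ≤ 1 / 2)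
    (x : Shift m) :
    lowerD T μ x = (d : ℝ) ∧ D T μ x = (d : ℝ) ↔
      (d : ℝ≥0∞) ≤ liminf (fun n => S T μ n x) atTop := by
  have hd : ((d : ℝ) : EReal) = (d : ℝ≥0∞) := by
    rw [← ENNReal.ofReal_natCast, EReal.coe_ennreal_ofReal, max_eq_left d.cast_nonneg]
  have hlow : lowerD T μ x = (d : ℝ) ↔ (d : ℝ≥0∞) ≤ liminf (fun n => S T μ n x) atTop := by
    rw [lowerD_eq hT hT2, hd, EReal.coe_ennreal_eq_coe_ennreal_iff, min_eq_left_iff]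
  refine ⟨fun h => hlow.1 h.1, fun h => ⟨hlow.2 h, ?_⟩⟩
  exact (D_le hT (hT2.trans (by norm_num)) x).antisymm (hlow.2 h ▸ lowerD_le_D T μ x)

lemma ae_exactDimensional_iff (hT : ∀ i, IsUnit (T i)) (hT2 : ratio T < 1 / 2) :
    (∀ᵐ a : Fin m → E d, ExactDimensional (μ.map (coding T a))) ↔
      ∃ C : ℝ, ∀ᵐ x ∂μ, lowerD T μ x = C ∧ D T μ x = C := by
  have hcont := continuous_coding (hT2.trans (by norm_num) : ratio T < 1)
  have hdim := ae_ae_locDim_eq (μ := μ) hT hT2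
  constructor
  · intro h
    obtain ⟨a, ⟨C, hC⟩, ha⟩ := (h.and hdim).exists
    refine ⟨C, ?_⟩
    filter_upwards [ae_of_ae_map (hcont a).aemeasurable hC, ha] with x hx ⟨hlow, hup⟩
    rwa [← hlow, ← hup]
  · rintro ⟨C, hC⟩
    filter_upwards [hdim] with a ha
    refine ⟨C, ae_map_of_ae_of_continuous (hcont a) ?_⟩
    filter_upwards [ha, hC] with x ⟨hlow, hup⟩ hx
    rwa [hlow, hup]

lemma exists_ae_lowerD_eq_and_D_eq_iff (hT : ∀ i, IsUnit (T i)) (hT2 : ratio T ≤ 1 / 2) :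
    (∃ C : ℝ, ∀ᵐ x ∂μ, lowerD T μ x = C ∧ D T μ x = C) ↔
      (∀ᵐ x ∂μ, (d : ℝ≥0∞) ≤ liminf (fun n => S T μ n x) atTop) ∨
        ∃ s : ℝ, 0 ≤ s ∧ s < d ∧
          ∀ᵐ x ∂μ, liminf (fun n => S T μ n x) atTop = ENNReal.ofReal s ∧ D T μ x = s := by
  have hT1 : ratio T ≤ 1 := hT2.trans (by norm_num)
  constructor
  · rintro ⟨C, hC⟩
    obtain ⟨x, hlow, hup⟩ := hC.exists
    have hC0 : 0 ≤ C := EReal.coe_nonneg.1 (hlow ▸ lowerD_nonneg hT hT1 x)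
    have hCd : C ≤ d := EReal.coe_le_coe_iff.1 (hup ▸ D_le hT hT1 x)
    rcases hCd.lt_or_eq with hCd | rfl
    · refine .inr ⟨C, hC0, hCd, ?_⟩
      simpa only [lowerD_eq_coe_iff_of_lt hT hT2 hC0 hCd] using hC
    · exact .inl (hC.mono fun x => (lowerD_eq_natCast_and_D_eq_natCast_iff hT hT2 x).1)
  · rintro (h | ⟨s, hs, hsd, h⟩)
    · exact ⟨d, h.mono fun x => (lowerD_eq_natCast_and_D_eq_natCast_iff hT hT2 x).2⟩
    · refine ⟨s, ?_⟩
      simpa only [lowerD_eq_coe_iff_of_lt hT hT2 hs hsd] using h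

end ExactDimensionality

end

end SelfAffine

theorem theorem1p2 {d m : ℕ} (hd : 1 ≤ d)
    (T : Fin m → Matrix (Fin d) (Fin d) ℝ)
    (hT_inv : ∀ i, IsUnit (T i))
    (hT_norm : ∀ i, SelfAffine.opNorm (T i) < 1 / 2)
    (μ : Measure (SelfAffine.Shift m)) [IsProbabilityMeasure μ] :
    (∀ᵐ a : Fin m → SelfAffine.E d,
        SelfAffine.ExactDimensional (μ.map (SelfAffine.coding T a))) ↔
      ((∀ᵐ x ∂μ, (d : ℝ≥0∞) ≤ liminf (fun n : ℕ => SelfAffine.S T μ n x) atTop) ∨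
        ∃ s : ℝ, 0 ≤ s ∧ s < d ∧
          ∀ᵐ x ∂μ, liminf (fun n : ℕ => SelfAffine.S T μ n x) atTop = ENNReal.ofReal s ∧
            SelfAffine.D T μ x = (s : EReal)) := by
  open SelfAffine in
  have hT2 : ratio T < 1 / 2 := ratio_lt_of_forall_opNorm_lt (by norm_num) hT_norm
  rw [ae_exactDimensional_iff hT_inv hT2, exists_ae_lowerD_eq_and_D_eq_iff hT_inv hT2.le]
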